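/- All Hilbert spaces are nonzero and finite dimensional, with a fixed standard basis. $\mathcal B(A)$ denotes the operators and $\mathfrak S(A)$ the density operators on $\mathcal H_A$; juxtaposition of labels denotes tensor products. The Choi matrix of a linear map $\Phi:\mathcal B(A_0)\to\mathcal B(A_1)$ is $C_\Phi=(\Phi\otimes \mathrm{id})(|I\rangle\!\rangle\langle\!\langle I|)$ with $|I\rangle\!\rangle=\sum_i|i\rangle\otimes|i\rangle$, and for $X\in\mathcal B(A_0A_1)$ put $\langle X,\Phi\rangle=\langle\!\langle I_{A_1}|(\Phi\otimes \mathrm{id})(X)|I_{A_1}\rangle\!\rangle$. Let $\|\Phi\|_\diamond=\max_{\rho\in\mathfrak S(A_0A_0)}\|(\Phi\otimes\mathrm{id})(\rho)\|_1$, and let $\|X\|^\diamond_{A_1|A_0}$ be the maximum of $\langle X,\phi\rangle$ over all maps $\phi$ such that $\alpha-\phi$ and $\alpha+\phi$ are completely positive for some channel $\alpha:\mathcal B(A_0)\to\mathcal B(A_1)$. For input-output spaces $A=A_0A_1$ and $A'=A'_0A'_1$, a superchannel from $A$ to $A'$ is a channel $\Theta:\mathcal B(A'_0A_1)\to\mathcal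 B(A'_1A_0)$ that is the concatenation, through some ancilla $S$, of a preprocessing channel $\mathcal B(A'_0)\to\mathcal B(SA_0)$ and a postprocessing channel $\mathcal B(SA_1)\to\mathcal B(A'_1)$; it transforms $\Phi:\mathcal B(A_0)\to\mathcal B(A_1)$ to $\Theta(\Phi):\mathcal B(A'_0)\to\mathcal B(A'_1)$ by $C_{\Theta(\Phi)}=C_\Theta*C_\Phi$, where $X*Y=\mathrm{Tr}_B[(X\otimes I_C)(I_A\otimes Y^{\mathsf T_B})]$ is the link product over the common system $B$. Let $\mathsf F$ be a convex subcategory of the category of quantum channels with superchannels: a set of admissible input-output spaces and, for admissible $A,A'$, a convex set $\mathsf F(A,A')$ of superchannels from $A$ to $A'$, closed under composition and containing the identities. For channels $\Phi_1,\Phi_2$ put $$\delta_{\mathsf F}(\Phi_1\|\Phi_2)=\inf_{\Lambda\in\mathsf F(A,A')}\|\Lambda(\Phi_1)-\Phi_2\|_\diamond,\qquad \|X\|^{\mathsf F}_{A'|A}=\sup_{\Theta\in\mathsf F(A,A')}\langle X,\Theta\rangle$$ for positive $X\in\mathcal B(A'_0A_1A'_1A_0)$, with $\inf\emptyset=+\infty$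 and $\sup\emptyset=-\infty$. (For the full category, $-\log\|X\|^{\mathsf F}_{A'|A}$ is the conditional 2-min-entropy.) **Theorem.** Let $A=A_0A_1$ and $A'=A'_0A'_1$ be admissible in $\mathsf F$, let $\Phi_1:\mathcal B(A_0)\to\mathcal B(A_1)$ and $\Phi_2:\mathcal B(A'_0)\to\mathcal B(A'_1)$ be channels and let $\epsilon\ge 0$. The following are equivalent. (i) $\delta_{\mathsf F}(\Phi_1\|\Phi_2)\le\epsilon$; (ii) for any $\rho\in\mathfrak S(A'_0A'_1)$ there is some $\Theta$ in the closure $\bar{\mathsf F}(A,A')$ of $\mathsf F(A,A')$ such that $$\langle\rho,\Phi_2\rangle\le\langle\rho,\Theta(\Phi_1)\rangle+\frac{\epsilon}{2}\|\rho\|^\diamond_{A'_1|A'_0};$$ (iii) for any $R=R_0R_1$ admissible in $\mathsf F$ and any $\rho\in\mathfrak S(R_0R_1)$, $$\|\rho*C_{\Phi_2}\|^{\mathsf F}_{R|A'}\le\|\rho*C_{\Phi_1}\|^{\mathsf F}_{R|A}+\frac{\epsilon}{2}\|\rho\|^\diamond_{R_1|R_0},$$ where $\rho$ and $C_{\Phi_i}$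 live on distinct systems, so that $\rho*C_{\Phi_i}=\rho\otimes C_{\Phi_i}$. Moreover, in (iii) it is enough to take the admissible $R$ with $R_0\simeq A'_0$ and $R_1\simeq A'_1$, and even only $R=A'$. -/

import Mathlib

open scoped Kronecker ComplexOrder

universe u

namespace ChannelComparison

/-! Finite dimensional Hilbert spaces come with a standard basis, indexed by a finite type;
operators are then matrices over `ℂ`, and tensor products are indexed by product types. -/

/-- The space `𝓑(A)` of all operators on the Hilbert space with standard basis indexed by `α`. -/
abbrev Op (α : Type*) : Type _ := Matrix α α ℂ

/-- Complex linear maps `𝓑(A) → 𝓑(B)`. -/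
abbrev LMap (α β : Type*) : Type _ := Op α →ₗ[ℂ] Op β

/-- A state: a positive operator of trace one. -/
def IsState {α : Type*} [Fintype α] (ρ : Op α) : Prop :=
  ρ.PosSemidef ∧ ρ.trace = 1

/-- The trace norm: the sum of the singular values. -/
noncomputable def traceNorm {α : Type*} [Fintype α] [DecidableEq α] (X : Op α) : ℝ :=
  ∑ i, Real.sqrt ((Matrix.isHermitian_conjTranspose_mul_self X).eigenvalues i)

/-- The map `Φ ⊗ id` on `𝓑(A) ⊗ 𝓑(R)`. -/
def tensorId {α β : Type*} (Φ : LMap α β) (κ : Type*) : LMap (α × κ) (β × κ) where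
  toFun X := Matrix.of fun p q => Φ (Matrix.of fun a a' => X (a, p.2) (a', q.2)) p.1 q.1
  map_add' X Y := by
    ext p q
    exact congrFun (congrFun (Φ.map_add (Matrix.of fun a a' => X (a, p.2) (a', q.2))
      (Matrix.of fun a a' => Y (a, p.2) (a', q.2))) p.1) q.1
  map_smul' c X := by
    ext p q
    exact congrFun (congrFun (Φ.map_smul c (Matrix.of fun a a' => X (a, p.2) (a', q.2))) p.1) q.1

/-- Complete positivity: `Φ ⊗ id` is positive for every finite dimensional ancilla. -/
def IsCP {α β : Type*} (Φ : LMap α β) : Prop :=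
  ∀ (n : ℕ) (X : Op (α × Fin n)), X.PosSemidef → (tensorId Φ (Fin n) X).PosSemidef

/-- Quantum channels: completely positive trace preserving maps. -/
def IsChannel {α β : Type*} [Fintype α] [Fintype β] (Φ : LMap α β) : Prop :=
  IsCP Φ ∧ ∀ X, (Φ X).trace = X.trace

/-- The vector `|I⟩⟩ = ∑ i, |i⟩ ⊗ |i⟩`. -/
def dket (α : Type*) [DecidableEq α] : α × α → ℂ := fun p => if p.1 = p.2 then 1 else 0

/-- The Choi matrix `C_Φ = (Φ ⊗ id)(|I⟩⟩⟨⟨I|)`. -/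
def choi {α β : Type*} [DecidableEq α] (Φ : LMap α β) : Op (β × α) :=
  tensorId Φ α (Matrix.vecMulVec (dket α) (star (dket α)))

theorem choi_apply {α β : Type*} [DecidableEq α] (Φ : LMap α β) (p q : β × α) :
    choi Φ p q = Φ (Matrix.single p.2 q.2 1) p.1 q.1 := by
  have h : (Matrix.of fun a a' =>
      (Matrix.vecMulVec (dket α) (star (dket α))) (a, p.2) (a', q.2))
      = Matrix.single p.2 q.2 (1 : ℂ) := by
    ext a a'
    by_cases h1 : a = p.2 <;> by_cases h2 : a' = q.2 <;>
      simp [Matrix.vecMulVec_apply, dket, h1, h2, eq_comm]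
  simp only [choi, tensorId, LinearMap.coe_mk, AddHom.coe_mk, Matrix.of_apply, h]

/-- The linear map with a given Choi matrix. -/
def ofChoi {α β : Type*} [Fintype α] (C : Op (β × α)) : LMap α β where
  toFun X := Matrix.of fun b b' => ∑ a, ∑ a', X a a' * C (b, a) (b', a')
  map_add' X Y := by
    ext b b'
    simp [add_mul, Finset.sum_add_distrib]
  map_smul' c X := by
    ext b b'
    simp [Finset.mul_sum, mul_assoc]

theorem choi_ofChoi {α β : Type*} [Fintype α] [DecidableEq α] (C : Op (β × α)) :
    choi (ofChoi C) = C := by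
  ext ⟨b, a⟩ ⟨b', a'⟩
  rw [choi_apply]
  simp only [ofChoi, LinearMap.coe_mk, AddHom.coe_mk, Matrix.of_apply]
  rw [Finset.sum_eq_single a, Finset.sum_eq_single a']
  · simp
  · intro x _ hx
    simp [Ne.symm hx]
  · simp
  · intro x _ hx
    simp [Ne.symm hx]
  · simp

theorem ofChoi_choi {α β : Type*} [Fintype α] [DecidableEq α] (Φ : LMap α β) :
    ofChoi (choi Φ) = Φ := by
  refine LinearMap.ext fun X => ?_
  ext b b'
  conv_rhs => rw [Matrix.matrix_eq_sum_single X]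
  simp only [ofChoi, LinearMap.coe_mk, AddHom.coe_mk, Matrix.of_apply, choi_apply, map_sum,
    Matrix.sum_apply]
  refine Finset.sum_congr rfl fun a _ => Finset.sum_congr rfl fun a' _ => ?_
  have : Matrix.single a a' (X a a') = X a a' • Matrix.single a a' (1 : ℂ) := by simp
  rw [this, map_smul]
  rfl

/-- Partial transpose of an operator on `B ⊗ C` with respect to `B`. -/
def partialTranspose {β γ : Type*} (Y : Op (β × γ)) : Op (β × γ) :=
  Matrix.of fun p q => Y (q.1, p.2) (p.1, q.2)

/-- The link product `X * Y = Tr_B[(X ⊗ I_C)(I_A ⊗ Y^{T_B})]` of operators on `A ⊗ B` and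
`B ⊗ C`. -/
def linkProduct {α β γ : Type*} [Fintype α] [Fintype β] [Fintype γ] [DecidableEq α]
    [DecidableEq γ] (X : Op (α × β)) (Y : Op (β × γ)) : Op (α × γ) :=
  Matrix.of fun p q => ∑ b,
    (Matrix.reindex (Equiv.prodAssoc α β γ) (Equiv.prodAssoc α β γ) (X ⊗ₖ (1 : Op γ)) *
      ((1 : Op α) ⊗ₖ partialTranspose Y)) (p.1, b, p.2) (q.1, b, q.2)

theorem linkProduct_apply {α β γ : Type*} [Fintype α] [Fintype β] [Fintype γ] [DecidableEq α]
    [DecidableEq γ] (X : Op (α × β)) (Y : Op (β × γ)) (p q : α × γ) :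
    linkProduct X Y p q = ∑ b, ∑ b', X (p.1, b) (q.1, b') * Y (b, p.2) (b', q.2) := by
  simp only [linkProduct, Matrix.of_apply, Matrix.mul_apply, Fintype.sum_prod_type]
  refine Finset.sum_congr rfl fun b _ => ?_
  simp [partialTranspose, Matrix.one_apply, Matrix.kroneckerMap_apply]

/-- The pairing `⟨X, φ⟩ = ⟨⟨I| (φ ⊗ id)(X) |I⟩⟩` of an operator `X` on `A ⊗ B` with a map
`φ : 𝓑(A) → 𝓑(B)`. It is real whenever `X` is hermitian and `φ` preserves hermitian operators. -/
def pairing {α β : Type*} [Fintype β] [DecidableEq β] (X : Op (α × β)) (φ : LMap α β) : ℝ :=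
  (star (dket β) ⬝ᵥ (tensorId φ β X).mulVec (dket β)).re

/-- The diamond norm `max_ρ ‖(Φ ⊗ id)(ρ)‖₁`, over states `ρ` on `A ⊗ A`. -/
noncomputable def diamondNorm {α β : Type*} [Fintype α] [Fintype β] [DecidableEq α]
    [DecidableEq β] (Φ : LMap α β) : ℝ :=
  sSup {t : ℝ | ∃ ρ : Op (α × α), IsState ρ ∧ t = traceNorm (tensorId Φ α ρ)}

/-- The dual norm `‖X‖^⋄_{B|A}` of an operator `X` on `A ⊗ B`: the maximum of `⟨X, φ⟩` over the
maps `φ` with `-α ≤ φ ≤ α` for some channel `α`, in the order given by complete positivity. -/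
noncomputable def dualDiamondNorm {α β : Type*} [Fintype α] [Fintype β] [DecidableEq β]
    (X : Op (α × β)) : ℝ :=
  sSup {t : ℝ | ∃ φ χ : LMap α β, IsChannel χ ∧ IsCP (χ - φ) ∧ IsCP (χ + φ) ∧ t = pairing X φ}

/-- A quantum system: a nonzero finite dimensional Hilbert space with a standard basis. -/
structure QSystem : Type (u + 1) where
  /-- The index set of the standard basis. -/
  idx : Type u
  [fintype : Fintype idx]
  [decEq : DecidableEq idx]
  [nonempty : Nonempty idx]

attribute [instance] QSystem.fintype QSystem.decEq QSystem.nonempty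

/-- An input-output space `A = A₀A₁`, representing the space of maps `𝓑(A₀) → 𝓑(A₁)`. -/
structure IOSpace : Type (u + 1) where
  /-- The input system `A₀`. -/
  inp : QSystem.{u}
  /-- The output system `A₁`. -/
  out : QSystem.{u}

/-- Linear maps `𝓑(A₀) → 𝓑(A₁)`. -/
abbrev IOSpace.Map (A : IOSpace.{u}) : Type u := LMap A.inp.idx A.out.idx

/-- Linear maps `𝓑(A'₀A₁) → 𝓑(A'₁A₀)`; these represent the transformations of maps in
`A = A₀A₁` to maps in `A' = A'₀A'₁`. -/
abbrev SuperMap (A A' : IOSpace.{u}) : Type u :=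
  LMap (A'.inp.idx × A.out.idx) (A'.out.idx × A.inp.idx)

/-- The action of a supermap: `C_{Θ(Φ)} = C_Θ * C_Φ`, the link product over `A₀A₁`. -/
def SuperMap.act {A A' : IOSpace.{u}} (Θ : SuperMap A A') (Φ : A.Map) : A'.Map :=
  ofChoi <|
    Matrix.reindex (Equiv.prodPUnit (A'.out.idx × A'.inp.idx))
      (Equiv.prodPUnit (A'.out.idx × A'.inp.idx)) <|
    linkProduct (β := A.inp.idx × A.out.idx)
      (Matrix.reindex
        (Equiv.prodProdProdComm A'.out.idx A.inp.idx A'.inp.idx A.out.idx)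
        (Equiv.prodProdProdComm A'.out.idx A.inp.idx A'.inp.idx A.out.idx) (choi Θ))
      (Matrix.reindex
        ((Equiv.prodComm A.out.idx A.inp.idx).trans (Equiv.prodPUnit.{u} _).symm)
        ((Equiv.prodComm A.out.idx A.inp.idx).trans (Equiv.prodPUnit.{u} _).symm) (choi Φ))

theorem SuperMap.choi_act_apply {A A' : IOSpace.{u}} (Θ : SuperMap A A') (Φ : A.Map)
    (p q : A'.out.idx × A'.inp.idx) :
    choi (SuperMap.act Θ Φ) p q = ∑ a₀, ∑ a₁, ∑ b₀, ∑ b₁,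
      choi Θ ((p.1, a₀), (p.2, a₁)) ((q.1, b₀), (q.2, b₁)) * choi Φ (a₁, a₀) (b₁, b₀) := by
  rw [SuperMap.act, choi_ofChoi]
  simp [linkProduct_apply, Fintype.sum_prod_type]

/-- The exchange of the last two factors of `R ⊗ A ⊗ B`. -/
def swapRight (κ α β : Type*) : (κ × α) × β ≃ (κ × β) × α where
  toFun p := ((p.1.1, p.2), p.1.2)
  invFun p := ((p.1.1, p.2), p.1.2)

/-- The concatenation of a preprocessing `𝓑(A'₀) → 𝓑(R A₀)` and a postprocessing
`𝓑(R A₁) → 𝓑(A'₁)`, as the map `𝓑(A'₀A₁) → 𝓑(R A₀ A₁) → 𝓑(A'₁A₀)`. -/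
def concat {A A' : IOSpace.{u}} {R : QSystem.{u}} (pre : LMap A'.inp.idx (R.idx × A.inp.idx))
    (post : LMap (R.idx × A.out.idx) A'.out.idx) : SuperMap A A' :=
  tensorId post A.inp.idx ∘ₗ
    (Matrix.reindexLinearEquiv ℂ ℂ
      (swapRight R.idx A.inp.idx A.out.idx)
      (swapRight R.idx A.inp.idx A.out.idx)).toLinearMap ∘ₗ
    tensorId pre A.out.idx

/-- Superchannels from `A` to `A'`: concatenations of a preprocessing channel and a
postprocessing channel, with some ancilla `R`. -/
def IsSuperchannel {A A' : IOSpace.{u}} (Θ : SuperMap A A') : Prop :=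
  ∃ (R : QSystem.{u}) (pre : LMap A'.inp.idx (R.idx × A.inp.idx))
    (post : LMap (R.idx × A.out.idx) A'.out.idx),
    IsChannel pre ∧ IsChannel post ∧ Θ = concat pre post

/-- A convex subcategory of the category of spaces of quantum channels with superchannels. The
identity and the composition of morphisms are those of the transformations `Φ ↦ Θ(Φ)`, which
determine `Θ`. -/
structure ConvexSubcategory : Type (u + 1) where
  /-- The objects: the admissible input-output spaces. -/
  adm : Set IOSpace.{u}
  /-- The morphisms `A → A'`; only used for admissible `A` and `A'`. -/
  hom : ∀ A A' : IOSpace.{u}, Set (SuperMap A A')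
  isSuperchannel : ∀ A ∈ adm, ∀ A' ∈ adm, ∀ Θ ∈ hom A A', IsSuperchannel Θ
  id_mem : ∀ A ∈ adm, ∃ Θ ∈ hom A A, ∀ Φ : A.Map, SuperMap.act Θ Φ = Φ
  comp_mem : ∀ A ∈ adm, ∀ A' ∈ adm, ∀ A'' ∈ adm, ∀ Θ ∈ hom A A', ∀ Λ ∈ hom A' A'',
    ∃ Ω ∈ hom A A'', ∀ Φ : A.Map, SuperMap.act Ω Φ = SuperMap.act Λ (SuperMap.act Θ Φ)
  convex : ∀ A ∈ adm, ∀ A' ∈ adm, Convex ℝ (hom A A')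

namespace ConvexSubcategory

/-- The conversion distance `δ_F(Φ₁‖Φ₂) = inf_Λ ‖Λ(Φ₁) - Φ₂‖_⋄` (`+∞` if there is no
morphism). -/
noncomputable def delta (F : ConvexSubcategory.{u}) {A A' : IOSpace.{u}} (Φ₁ : A.Map)
    (Φ₂ : A'.Map) : EReal :=
  ⨅ Λ ∈ F.hom A A', ((diamondNorm (SuperMap.act Λ Φ₁ - Φ₂) : ℝ) : EReal)

/-- The closure of the set of morphisms `A → A'`. The topology is the unique Hausdorff vector space
topology, transported from matrices by the linear isomorphism `Θ ↦ C_Θ`. -/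
def closedHom (F : ConvexSubcategory.{u}) (A A' : IOSpace.{u}) : Set (SuperMap A A') :=
  {Θ | choi Θ ∈ closure (choi '' F.hom A A')}

/-- The quantity `‖X‖^F_{A'|A} = sup_Θ ⟨X, Θ⟩` over all morphisms `Θ : A → A'`, for an operator
`X` on `A'₀A₁A'₁A₀` (`-∞` if there is no morphism). -/
noncomputable def modNorm (F : ConvexSubcategory.{u}) (A A' : IOSpace.{u})
    (X : Op ((A'.inp.idx × A.out.idx) × (A'.out.idx × A.inp.idx))) : EReal :=
  ⨆ Θ ∈ F.hom A A', ((pairing X Θ : ℝ) : EReal)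

end ConvexSubcategory

/-- The link product `ρ * C_Φ` of an operator on `R₀R₁` with the Choi matrix of `Φ`, where
`R₀, R₁, A₀, A₁` are distinct systems: the tensor product `ρ ⊗ C_Φ`, as an operator on
`R₀A₁R₁A₀`. -/
def linkChoi {R A : IOSpace.{u}} (ρ : Op (R.inp.idx × R.out.idx)) (Φ : A.Map) :
    Op ((R.inp.idx × A.out.idx) × (R.out.idx × A.inp.idx)) :=
  Matrix.reindex (Equiv.prodProdProdComm R.inp.idx R.out.idx A.out.idx A.inp.idx)
    (Equiv.prodProdProdComm R.inp.idx R.out.idx A.out.idx A.inp.idx) (ρ ⊗ₖ choi Φ)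

end ChannelComparison

open ChannelComparison

/-! Everything reduces to one order relation, `Dominates`: for some Θ in F(A, A') and some channel
χ, the map tχ − (Φ₂ − Θ(Φ₁)) is completely positive. Condition (i) says that this holds for every t
> ε/2. The infimum over F need not be attained, hence the strict inequality.

For one difference of channels, half the diamond norm governs domination by multiples of a channel.
If tχ dominates Φ − Ψ, then ((Φ − Ψ) ⊗ id)(ω) is traceless and lies below t times a state, so its
trace norm is at most 2t. Conversely, if no tχ dominates, separation of convex sets gives 0 ≤ ρ ≤ 1
⊗ σ with σ a state and ⟨ρ, C_Φ − C_Ψ⟩ ≥ t. Factoring σ = VV* turns ρ into a test 0 ≤ P ≤ 1 on the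
output of a pure input, so half the diamond norm is at least t (`dotRe_choi_sub_le`).

The same separation lemma, `exists_dominated_or_exists_witness`, takes the place of a minimax
theorem. Applied to the convex set of all C_{Φ₂} − C_{Θ(Φ₁)}, it yields one ρ that works against
every Θ. The bound ρ ≤ 1 ⊗ σ controls the dual norm of ρ, so its normalisation refutes (ii). Hence
(ii) implies (i).

Domination survives superchannels and composition in F, so pairing with ρ and letting t tend to ε/2
gives (iii). With R = A' and the identity morphism, (iii) returns (ii) up to arbitrarily small
slack, which compactness of the closure of F(A, A') removes. -/

namespace ChannelComparison

open scoped MatrixOrder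

/-! ### The bilinear pairing of matrices and the positive cone -/

section DotRe

variable {ι : Type*} [Fintype ι]

/-- The real bilinear pairing `Re ∑ X p q * Y p q` of matrices. -/
noncomputable def dotRe (X Y : Op ι) : ℝ := (∑ p, ∑ q, X p q * Y p q).re

theorem dotRe_comm (X Y : Op ι) : dotRe X Y = dotRe Y X := by
  simp only [dotRe, mul_comm]

theorem dotRe_add (X Y Z : Op ι) : dotRe X (Y + Z) = dotRe X Y + dotRe X Z := by
  simp [dotRe, mul_add, Finset.sum_add_distrib]

theorem dotRe_sub (X Y Z : Op ι) : dotRe X (Y - Z) = dotRe X Y - dotRe X Z := by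
  simp [dotRe, mul_sub, Finset.sum_sub_distrib]

theorem dotRe_smul (X Y : Op ι) (c : ℝ) : dotRe X (c • Y) = c * dotRe X Y := by
  simp only [dotRe, Complex.re_sum, Finset.mul_sum, Matrix.smul_apply]
  refine Finset.sum_congr rfl fun p _ => Finset.sum_congr rfl fun q _ => ?_
  simp
  ring

theorem sub_dotRe (X Y Z : Op ι) : dotRe (X - Y) Z = dotRe X Z - dotRe Y Z := by
  simp only [dotRe_comm _ Z, dotRe_sub]

theorem add_dotRe (X Y Z : Op ι) : dotRe (X + Y) Z = dotRe X Z + dotRe Y Z := by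
  simp only [dotRe_comm _ Z, dotRe_add]

theorem smul_dotRe (X Y : Op ι) (c : ℝ) : dotRe (c • X) Y = c * dotRe X Y := by
  simp only [dotRe_comm _ Y, dotRe_smul]

theorem continuous_dotRe (X : Op ι) : Continuous fun Y => dotRe X Y := by
  unfold dotRe
  fun_prop

theorem dotRe_vecMulVec (X : Op ι) (z : ι → ℂ) :
    dotRe X (Matrix.vecMulVec z (star z)) = (z ⬝ᵥ X.mulVec (star z)).re := by
  simp only [dotRe, dotProduct, Matrix.mulVec, Matrix.vecMulVec_apply, Finset.mul_sum]
  congr 1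
  refine Finset.sum_congr rfl fun p _ => Finset.sum_congr rfl fun q _ => ?_
  ring

/-- By Schur's theorem the entrywise product is positive; the pairing is its quadratic form at the
all-ones vector. -/
theorem dotRe_nonneg {X Y : Op ι} (hX : X.PosSemidef) (hY : Y.PosSemidef) : 0 ≤ dotRe X Y := by
  have h := (hX.hadamard hY).re_dotProduct_nonneg 1
  simpa [dotRe, dotProduct, Matrix.mulVec, Matrix.hadamard_apply] using h

theorem dotRe_le_dotRe {X Y Z : Op ι} (hX : X.PosSemidef) (h : (Z - Y).PosSemidef) :
    dotRe X Y ≤ dotRe X Z := by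
  have := dotRe_nonneg hX h
  rw [dotRe_sub] at this
  linarith

theorem posSemidef_of_dotRe_nonneg {X : Op ι} (hX : X.IsHermitian)
    (h : ∀ z : ι → ℂ, 0 ≤ dotRe X (Matrix.vecMulVec z (star z))) : X.PosSemidef := by
  refine .of_dotProduct_mulVec_nonneg hX fun z => ?_
  rw [RCLike.nonneg_iff]
  refine ⟨?_, hX.im_star_dotProduct_mulVec_self z⟩
  have := h (star z)
  rw [dotRe_vecMulVec, star_star] at this
  exact this

theorem isHermitian_real_smul {ι : Type*} {X : Op ι} (hX : X.IsHermitian) (c : ℝ) :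
    (c • X).IsHermitian := by
  ext p q
  have := hX.apply p q
  simp only [Matrix.conjTranspose_apply, Matrix.smul_apply] at *
  rw [← this]
  simp

theorem posSemidef_real_smul {ι : Type*} {X : Op ι} (hX : X.PosSemidef) {c : ℝ} (hc : 0 ≤ c) :
    (c • X).PosSemidef :=
  hX.smul hc

theorem dotRe_one [DecidableEq ι] (X : Op ι) : dotRe X 1 = X.trace.re := by
  simp [dotRe, Matrix.one_apply, Matrix.trace]

theorem dotRe_eq_trace (X Y : Op ι) : dotRe X Y = (X.transpose * Y).trace.re := by
  simp only [dotRe, Matrix.trace, Matrix.diag, Matrix.mul_apply, Matrix.transpose_apply]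
  rw [Finset.sum_comm]

theorem PosSemidef.trace_re_pos {X : Op ι} (hX : X.PosSemidef) (h : X ≠ 0) : 0 < X.trace.re := by
  have h0 := hX.trace_nonneg
  rw [Complex.nonneg_iff] at h0
  refine lt_of_le_of_ne h0.1 fun h1 => h ?_
  exact hX.trace_eq_zero_iff.1 (Complex.ext h1.symm h0.2.symm)

theorem PosSemidef.trace_eq_re {X : Op ι} (hX : X.PosSemidef) : X.trace = (X.trace.re : ℂ) := by
  have h0 := hX.trace_nonneg
  rw [Complex.nonneg_iff] at h0
  exact Complex.ext rfl h0.2.symm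

/-- A nonzero positive operator can be normalised to a state. -/
theorem PosSemidef.isState_smul {X : Op ι} (hX : X.PosSemidef) (h : X ≠ 0) :
    IsState ((X.trace.re)⁻¹ • X) := by
  have h0 := PosSemidef.trace_re_pos hX h
  refine ⟨posSemidef_real_smul hX (by positivity), ?_⟩
  rw [Matrix.trace_smul, PosSemidef.trace_eq_re hX, Complex.real_smul, Complex.ofReal_re]
  rw [← Complex.ofReal_mul, inv_mul_cancel₀ h0.ne', Complex.ofReal_one]

/-- The entries of a positive operator are bounded by its trace. -/
theorem PosSemidef.norm_apply_le {X : Op ι} (hX : X.PosSemidef) (i j : ι) :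
    ‖X i j‖ ≤ X.trace.re := by
  classical
  obtain ⟨B, rfl⟩ := CStarAlgebra.nonneg_iff_eq_star_mul_self.1 (Matrix.nonneg_iff_posSemidef.2 hX)
  have hcol : ∀ j, ∑ k, ‖B k j‖ ^ 2 ≤ (star B * B).trace.re := fun j => by
    have : (star B * B).trace.re = ∑ j, ∑ k, ‖B k j‖ ^ 2 := by
      simp [Matrix.star_eq_conjTranspose, Matrix.trace, Matrix.mul_apply, Complex.mul_re,
        Complex.sq_norm, Complex.normSq_apply]
    rw [this]
    exact Finset.single_le_sum (f := fun j => ∑ k, ‖B k j‖ ^ 2)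
      (fun j _ => Finset.sum_nonneg fun k _ => sq_nonneg _) (Finset.mem_univ j)
  calc ‖(star B * B) i j‖ ≤ ∑ k, ‖B k i‖ * ‖B k j‖ := by
        rw [Matrix.mul_apply]
        refine (norm_sum_le _ _).trans_eq (Finset.sum_congr rfl fun k _ => ?_)
        simp
    _ ≤ ∑ k, (‖B k i‖ ^ 2 + ‖B k j‖ ^ 2) / 2 :=
        Finset.sum_le_sum fun k _ => by nlinarith [sq_nonneg (‖B k i‖ - ‖B k j‖)]
    _ = (∑ k, ‖B k i‖ ^ 2 + ∑ k, ‖B k j‖ ^ 2) / 2 := by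
        rw [← Finset.sum_div, Finset.sum_add_distrib]
    _ ≤ _ := by linarith [hcol i, hcol j]

end DotRe

/-! ### Trace norm of hermitian and traceless operators -/

section TraceNorm

variable {ι : Type*} [Fintype ι] [DecidableEq ι]

theorem traceNorm_neg (X : Op ι) : traceNorm (-X) = traceNorm X := by
  simp [traceNorm]

theorem star_eigenvectorUnitary_mul_mul {H : Op ι} (hH : H.IsHermitian) :
    star (hH.eigenvectorUnitary : Op ι) * H * (hH.eigenvectorUnitary : Op ι)
      = Matrix.diagonal fun i => (hH.eigenvalues i : ℂ) := by
  have := hH.conjStarAlgAut_star_eigenvectorUnitary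
  rw [Unitary.conjStarAlgAut_apply] at this
  simpa [Function.comp_def] using this

/-- H*H and the square of the diagonalised H have the same characteristic polynomial, so the two
spectra agree as multisets; the individual orderings need not match. -/
theorem traceNorm_eq_sum_abs {H : Op ι} (hH : H.IsHermitian) :
    traceNorm H = ∑ i, |hH.eigenvalues i| := by
  have hU : (hH.eigenvectorUnitary : Op ι) * star (hH.eigenvectorUnitary : Op ι) = 1 :=
    Unitary.coe_mul_star_self _
  set U : Op ι := hH.eigenvectorUnitary.1 with hUdef
  set D : Op ι := Matrix.diagonal fun i => (hH.eigenvalues i : ℂ) with hD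
  have h1 : star U * H * U = D := star_eigenvectorUnitary_mul_mul hH
  have h2 : (H.conjTranspose * H).charpoly = (D * D).charpoly := by
    rw [hH.eq, ← h1, show star U * H * U * (star U * H * U) = star U * (H * (U * star U) * H * U) by
      simp only [mul_assoc], hU, mul_one, Matrix.charpoly_mul_comm (star U), mul_assoc (H * H), hU,
      mul_one]
  have h3 := (Matrix.isHermitian_conjTranspose_mul_self H).roots_charpoly_eq_eigenvalues
  have h4 : (D * D).charpoly.roots
      = Multiset.map (fun i => ((hH.eigenvalues i ^ 2 : ℝ) : ℂ)) Finset.univ.val := by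
    rw [hD, Matrix.diagonal_mul_diagonal, Matrix.charpoly_diagonal, Finset.prod]
    have := Multiset.map_map (fun a => Polynomial.X - Polynomial.C a)
        (fun i => (hH.eigenvalues i : ℂ) * hH.eigenvalues i) Finset.univ.val
    simp only [Function.comp_def] at this
    rw [← this, Polynomial.roots_multiset_prod_X_sub_C]
    simp [sq]
  rw [h2, h4] at h3
  have h5 := congrArg (fun s => (Multiset.map (fun z : ℂ => Real.sqrt z.re) s).sum) h3
  simp only [Multiset.map_map, Function.comp_def, Complex.ofReal_re, Real.sqrt_sq_eq_abs] at h5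
  exact h5.symm

/-- The eigenvalues sum to zero, and |λ| + λ = 2 max(λ, 0). -/
theorem traceNorm_eq_sum_posPart {H : Op ι} (hH : H.IsHermitian) (h0 : H.trace = 0) :
    traceNorm H = 2 * ∑ i, max (hH.eigenvalues i) 0 := by
  have h1 : ∑ i, hH.eigenvalues i = 0 := by
    have := hH.trace_eq_sum_eigenvalues
    rw [h0] at this
    exact_mod_cast Complex.ofReal_injective (by simpa using this.symm)
  rw [traceNorm_eq_sum_abs hH, Finset.mul_sum, ← add_zero (∑ i, |_|)]
  nth_rw 1 [← h1]
  rw [← Finset.sum_add_distrib]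
  refine Finset.sum_congr rfl fun i _ => ?_
  rcases le_total 0 (hH.eigenvalues i) with hl | hl
  · rw [max_eq_left hl, abs_of_nonneg hl]; ring
  · rw [max_eq_right hl, abs_of_nonpos hl]; ring

/-- A traceless hermitian operator bounded by `c` times a state has trace norm at most `2 c`. -/
theorem traceNorm_le_of_le_smul {H τ : Op ι} {c : ℝ} (hH : H.IsHermitian) (h0 : H.trace = 0)
    (hτ : IsState τ) (hc : 0 ≤ c) (h : (c • τ - H).PosSemidef) : traceNorm H ≤ 2 * c := by
  rw [traceNorm_eq_sum_posPart hH h0]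
  have hU : (hH.eigenvectorUnitary : Op ι) * star (hH.eigenvectorUnitary : Op ι) = 1 :=
    Unitary.coe_mul_star_self _
  have h1 := star_eigenvectorUnitary_mul_mul hH
  set U : Op ι := hH.eigenvectorUnitary.1 with hUdef
  have hτ' : (star U * τ * U).PosSemidef := hτ.1.conjTranspose_mul_mul_same U
  have htr : (star U * τ * U).trace = 1 := by
    rw [Matrix.trace_mul_comm, ← mul_assoc, hU, one_mul, hτ.2]
  have hd : (c • (star U * τ * U) - Matrix.diagonal fun i => (hH.eigenvalues i : ℂ)).PosSemidef := by
    have := h.conjTranspose_mul_mul_same U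
    rw [← h1]
    convert this using 1
    simp [mul_sub, sub_mul, Matrix.star_eq_conjTranspose]
  have hi : ∀ i, max (hH.eigenvalues i) 0 ≤ c * ((star U * τ * U) i i).re := fun i => by
    refine max_le ?_ (mul_nonneg hc (Complex.nonneg_iff.1 hτ'.diag_nonneg).1)
    have := (Complex.nonneg_iff.1 (hd.diag_nonneg (i := i))).1
    simpa using this
  have hs : ∑ i, ((star U * τ * U) i i).re = 1 := by
    have := congrArg Complex.re htr
    simpa [Matrix.trace] using this
  calc 2 * ∑ i, max (hH.eigenvalues i) 0 ≤ 2 * ∑ i, c * ((star U * τ * U) i i).re := by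
        gcongr with i
        exact hi i
    _ = 2 * c := by rw [← Finset.mul_sum, hs, mul_one]

/-- In an eigenbasis of H the diagonal entries of the transpose of P lie in [0, 1], so each
eigenvalue contributes at most its positive part. The transpose appears because the pairing has no
conjugation. -/
theorem dotRe_le_half_traceNorm {H P : Op ι} (hH : H.IsHermitian) (h0 : H.trace = 0)
    (hP : P.PosSemidef) (hP1 : (1 - P).PosSemidef) : dotRe P H ≤ traceNorm H / 2 := by
  rw [traceNorm_eq_sum_posPart hH h0, mul_div_cancel_left₀ _ two_ne_zero, dotRe_eq_trace]
  have hU : (hH.eigenvectorUnitary : Op ι) * star (hH.eigenvectorUnitary : Op ι) = 1 :=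
    Unitary.coe_mul_star_self _
  have hU' : star (hH.eigenvectorUnitary : Op ι) * (hH.eigenvectorUnitary : Op ι) = 1 :=
    Unitary.coe_star_mul_self _
  have h1 := star_eigenvectorUnitary_mul_mul hH
  set U : Op ι := hH.eigenvectorUnitary.1 with hUdef
  have hP' : (star U * P.transpose * U).PosSemidef :=
    hP.transpose.conjTranspose_mul_mul_same U
  have hP1' : (1 - star U * P.transpose * U).PosSemidef := by
    have := hP1.transpose.conjTranspose_mul_mul_same U
    have e : 1 - star U * P.transpose * U = U.conjTranspose * (1 - P).transpose * U := by
      rw [← Matrix.star_eq_conjTranspose, Matrix.transpose_sub, Matrix.transpose_one, mul_sub,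
        sub_mul, mul_one, hU']
    rw [e]
    exact this
  have ht : (P.transpose * H).trace = ((star U * P.transpose * U) *
      Matrix.diagonal fun i => (hH.eigenvalues i : ℂ)).trace := by
    rw [← h1, show star U * P.transpose * U * (star U * H * U)
      = star U * (P.transpose * (U * star U) * H * U) by simp only [mul_assoc], hU, mul_one,
      Matrix.trace_mul_comm (star U),
      Matrix.mul_assoc (P.transpose * H), hU, mul_one]
  rw [ht]
  simp only [Matrix.trace, Matrix.diag, Matrix.mul_diagonal, Complex.re_sum]
  refine Finset.sum_le_sum fun i _ => ?_
  have a := (Complex.nonneg_iff.1 (hP'.diag_nonneg (i := i))).1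
  have b := (Complex.nonneg_iff.1 (hP1'.diag_nonneg (i := i))).1
  simp only [Matrix.sub_apply, Matrix.one_apply_eq, Complex.sub_re, Complex.one_re] at b
  rw [Complex.re_mul_ofReal]
  rcases le_total 0 (hH.eigenvalues i) with hl | hl
  · rw [max_eq_left hl]; nlinarith
  · rw [max_eq_right hl]; nlinarith

end TraceNorm

/-! ### Choi matrices, channels and partial traces -/

section Choi

variable {α β : Type*}

theorem posSemidef_of_eq {X Y : Op α} (hX : X.PosSemidef) (h : Y = X) : Y.PosSemidef := h ▸ hX

/-- Contraction of two positive operators along a common index is positive. -/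
theorem posSemidef_contract {ι μ ν σ : Type*} [Fintype ι] [Fintype μ] [Fintype ν] [Fintype σ]
    {X : Op μ} {Y : Op ν} (hX : X.PosSemidef) (hY : Y.PosSemidef) (f : ι → σ → μ)
    (g : ι → σ → ν) :
    (Matrix.of fun i j => ∑ s, ∑ t, X (f i s) (f j t) * Y (g i s) (g j t)).PosSemidef := by
  classical
  -- Take the Schur product over the enlarged index `ι × σ`, then compress by the 0-1 matrix that
  -- sums out `σ`.
  have hN := (hX.submatrix fun p : ι × σ => f p.1 p.2).hadamard
    (hY.submatrix fun p : ι × σ => g p.1 p.2)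
  have := hN.conjTranspose_mul_mul_same
    (Matrix.of fun (p : ι × σ) (j : ι) => if p.1 = j then (1 : ℂ) else 0)
  refine posSemidef_of_eq this ?_
  ext i j
  simp only [Matrix.of_apply, Matrix.mul_apply, Matrix.hadamard_apply, Matrix.submatrix_apply,
    Matrix.conjTranspose_apply, Fintype.sum_prod_type, apply_ite star, star_one, star_zero,
    mul_ite, mul_one, mul_zero, ite_mul, one_mul, zero_mul]
  rw [Finset.sum_eq_single j (by intro x _ hx; simp [hx]) (by simp)]
  simp only [if_true]
  rw [Finset.sum_comm]
  refine Finset.sum_congr rfl fun t _ => ?_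
  rw [Finset.sum_eq_single i (by intro x _ hx; simp [hx]) (by simp)]
  simp

/-- The partial trace over the output of a Choi matrix. -/
def outTrace [Fintype β] (Q : Op (β × α)) : Op α := Matrix.of fun a a' => ∑ b, Q (b, a) (b, a')

theorem outTrace_add [Fintype β] (P Q : Op (β × α)) :
    outTrace (P + Q) = outTrace P + outTrace Q := by
  ext; simp [outTrace, Finset.sum_add_distrib]

theorem outTrace_smul [Fintype β] (c : ℝ) (Q : Op (β × α)) :
    outTrace (c • Q) = c • outTrace Q := by
  ext; simp [outTrace, Finset.mul_sum]

theorem outTrace_one_kronecker [Fintype β] [DecidableEq β] (σ : Op α) :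
    outTrace ((1 : Op β) ⊗ₖ σ) = (Fintype.card β : ℝ) • σ := by
  ext; simp [outTrace]

theorem trace_outTrace [Fintype α] [Fintype β] (Q : Op (β × α)) :
    (outTrace Q).trace = Q.trace := by
  simp only [outTrace, Matrix.trace, Matrix.diag, Matrix.of_apply, Fintype.sum_prod_type]
  rw [Finset.sum_comm]

theorem dotRe_one_kronecker [Fintype α] [Fintype β] [DecidableEq β] (σ : Op α) (Q : Op (β × α)) :
    dotRe ((1 : Op β) ⊗ₖ σ) Q = dotRe σ (outTrace Q) := by
  simp only [dotRe, outTrace, Fintype.sum_prod_type, Matrix.kroneckerMap_apply, Matrix.of_apply,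
    Matrix.one_apply, ite_mul, one_mul, zero_mul]
  congr 1
  rw [Finset.sum_comm]
  refine Finset.sum_congr rfl fun a _ => ?_
  simp only [Finset.mul_sum]
  conv_rhs => rw [Finset.sum_comm]
  refine Finset.sum_congr rfl fun b _ => ?_
  rw [Finset.sum_comm]
  simp

theorem outTrace_isHermitian [Fintype β] {Q : Op (β × α)} (hQ : Q.IsHermitian) :
    (outTrace Q).IsHermitian := by
  ext a a'
  simp only [outTrace, Matrix.conjTranspose_apply, Matrix.of_apply, star_sum]
  exact Finset.sum_congr rfl fun b _ => hQ.apply _ _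

theorem choi_add [DecidableEq α] (Φ Ψ : LMap α β) : choi (Φ + Ψ) = choi Φ + choi Ψ := by
  ext; simp [choi_apply]

theorem choi_sub [DecidableEq α] (Φ Ψ : LMap α β) : choi (Φ - Ψ) = choi Φ - choi Ψ := by
  ext; simp [choi_apply]

theorem choi_smul [DecidableEq α] (c : ℝ) (Φ : LMap α β) : choi (c • Φ) = c • choi Φ := by
  ext; simp [choi_apply]

theorem tensorId_apply [Fintype α] [DecidableEq α] (Φ : LMap α β) (κ : Type*) (X : Op (α × κ))
    (p q : β × κ) :
    tensorId Φ κ X p q = ∑ a, ∑ a', X (a, p.2) (a', q.2) * choi Φ (p.1, a) (q.1, a') := by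
  conv_lhs => rw [← ofChoi_choi Φ]
  simp [tensorId, ofChoi]

theorem tensorId_sub (Φ Ψ : LMap α β) (κ : Type*) (X : Op (α × κ)) :
    tensorId (Φ - Ψ) κ X = tensorId Φ κ X - tensorId Ψ κ X := by
  ext; simp [tensorId]

theorem posSemidef_tensorId [Fintype α] [DecidableEq α] [Fintype β] {κ : Type*} [Fintype κ]
    {Φ : LMap α β} (hΦ : (choi Φ).PosSemidef) {X : Op (α × κ)} (hX : X.PosSemidef) :
    (tensorId Φ κ X).PosSemidef := by
  have := posSemidef_contract hX hΦ (fun (p : β × κ) a => (a, p.2)) (fun p a => (p.1, a))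
  refine posSemidef_of_eq this ?_
  ext p q
  simp [tensorId_apply]

/-- Choi's theorem: an ancilla of the size of the input suffices, since the Choi matrix is the image
of an unnormalised maximally entangled state. -/
theorem isCP_iff [Fintype α] [DecidableEq α] [Fintype β] {Φ : LMap α β} :
    IsCP Φ ↔ (choi Φ).PosSemidef := by
  refine ⟨fun h => ?_, fun h n X hX => posSemidef_tensorId h hX⟩
  let e := Fintype.equivFin α
  have h1 := h _ _ (Matrix.posSemidef_vecMulVec_self_star
    (fun p : α × Fin (Fintype.card α) => dket α (p.1, e.symm p.2)))
  have h2 := h1.submatrix fun p : β × α => (p.1, e p.2)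
  refine posSemidef_of_eq h2 ?_
  ext p q
  simp [choi, tensorId, Matrix.vecMulVec_apply]

theorem outTrace_choi_apply [DecidableEq α] [Fintype β] (Φ : LMap α β) (a a' : α) :
    outTrace (choi Φ) a a' = (Φ (Matrix.single a a' 1)).trace := by
  simp [outTrace, choi_apply, Matrix.trace]

theorem isChannel_iff [Fintype α] [DecidableEq α] [Fintype β] {Φ : LMap α β} :
    IsChannel Φ ↔ (choi Φ).PosSemidef ∧ outTrace (choi Φ) = 1 := by
  rw [IsChannel, isCP_iff]
  refine and_congr_right fun _ => ⟨fun h => ?_, fun h X => ?_⟩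
  · ext a a'
    rw [outTrace_choi_apply, h, Matrix.one_apply]
    split_ifs with ha
    · subst ha; simp
    · exact Matrix.trace_single_eq_of_ne a a' 1 ha
  · conv_lhs => rw [← ofChoi_choi Φ]
    simp only [Matrix.trace, Matrix.diag, ofChoi, LinearMap.coe_mk, AddHom.coe_mk, Matrix.of_apply]
    rw [Finset.sum_comm]
    refine Finset.sum_congr rfl fun a _ => ?_
    rw [Finset.sum_comm]
    have : ∀ a', ∑ b, X a a' * choi Φ (b, a) (b, a') = X a a' * (1 : Op α) a a' := fun a' => by
      rw [← Finset.mul_sum, ← h, outTrace, Matrix.of_apply]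
    simp [this, Matrix.one_apply]

theorem trace_tensorId [Fintype α] [DecidableEq α] [Fintype β] {κ : Type*} [Fintype κ]
    (Φ : LMap α β) (X : Op (α × κ)) :
    (tensorId Φ κ X).trace
      = ∑ k, ∑ a, ∑ a', X (a, k) (a', k) * outTrace (choi Φ) a a' := by
  simp only [Matrix.trace, Matrix.diag, tensorId_apply, Fintype.sum_prod_type, outTrace,
    Matrix.of_apply, Finset.mul_sum]
  rw [Finset.sum_comm]
  refine Finset.sum_congr rfl fun k _ => ?_
  rw [Finset.sum_comm]
  refine Finset.sum_congr rfl fun a _ => ?_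
  rw [Finset.sum_comm]

theorem IsChannel.isState_tensorId [Fintype α] [DecidableEq α] [Fintype β] {κ : Type*} [Fintype κ]
    {Φ : LMap α β} (hΦ : IsChannel Φ) {X : Op (α × κ)} (hX : IsState X) :
    IsState (tensorId Φ κ X) := by
  obtain ⟨h1, h2⟩ := isChannel_iff.1 hΦ
  refine ⟨posSemidef_tensorId h1 hX.1, ?_⟩
  rw [trace_tensorId, h2, ← hX.2]
  simp only [Matrix.trace, Matrix.diag, Fintype.sum_prod_type, Matrix.one_apply]
  rw [Finset.sum_comm]
  simp

/-- The pairing as a bilinear form in the Choi matrix. -/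
theorem pairing_eq_dotRe [Fintype α] [DecidableEq α] [Fintype β] [DecidableEq β] (X : Op (α × β))
    (φ : LMap α β) : pairing X φ = dotRe (X.submatrix Prod.swap Prod.swap) (choi φ) := by
  have h : star (dket β) ⬝ᵥ (tensorId φ β X).mulVec (dket β)
      = ∑ b, ∑ b', tensorId φ β X (b, b) (b', b') := by
    simp [dotProduct, Matrix.mulVec, dket, Fintype.sum_prod_type]
  rw [pairing, h, dotRe]
  simp only [tensorId_apply, Fintype.sum_prod_type, Matrix.submatrix_apply, Prod.swap_prod_mk]
  congr 1
  refine Finset.sum_congr rfl fun b _ => ?_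
  rw [Finset.sum_comm]

theorem pairing_add [Fintype β] [DecidableEq β] (X : Op (α × β)) (φ ψ : LMap α β) :
    pairing X (φ + ψ) = pairing X φ + pairing X ψ := by
  have : tensorId (φ + ψ) β X = tensorId φ β X + tensorId ψ β X := by ext; simp [tensorId]
  simp [pairing, this, Matrix.add_mulVec]

end Choi

/-! ### Action and normalisation of superchannels -/

section Superchannel

variable {A A' : IOSpace.{u}}

theorem choi_injective {α β : Type*} [Fintype α] [DecidableEq α] :
    Function.Injective (choi : LMap α β → Op (β × α)) :=
  Function.LeftInverse.injective ofChoi_choi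

theorem SuperMap.act_add (Θ : SuperMap A A') (Φ Ψ : A.Map) :
    SuperMap.act Θ (Φ + Ψ) = SuperMap.act Θ Φ + SuperMap.act Θ Ψ := by
  refine choi_injective ?_
  ext p q
  simp only [choi_add, Matrix.add_apply, SuperMap.choi_act_apply, mul_add, Finset.sum_add_distrib]

theorem SuperMap.act_smul (c : ℝ) (Θ : SuperMap A A') (Φ : A.Map) :
    SuperMap.act Θ (c • Φ) = c • SuperMap.act Θ Φ := by
  refine choi_injective ?_
  ext p q
  simp only [choi_smul, Matrix.smul_apply, SuperMap.choi_act_apply, mul_smul_comm, Finset.smul_sum]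

theorem SuperMap.add_act (Θ Λ : SuperMap A A') (Φ : A.Map) :
    SuperMap.act (Θ + Λ) Φ = SuperMap.act Θ Φ + SuperMap.act Λ Φ := by
  refine choi_injective ?_
  ext p q
  simp only [choi_add, Matrix.add_apply, SuperMap.choi_act_apply, add_mul, Finset.sum_add_distrib]

theorem SuperMap.smul_act (c : ℝ) (Θ : SuperMap A A') (Φ : A.Map) :
    SuperMap.act (c • Θ) Φ = c • SuperMap.act Θ Φ := by
  refine choi_injective ?_
  ext p q
  simp only [choi_smul, Matrix.smul_apply, SuperMap.choi_act_apply, smul_mul_assoc,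
    Finset.smul_sum]

theorem SuperMap.posSemidef_choi_act {Θ : SuperMap A A'} (hΘ : (choi Θ).PosSemidef) {Φ : A.Map}
    (hΦ : (choi Φ).PosSemidef) : (choi (SuperMap.act Θ Φ)).PosSemidef := by
  refine posSemidef_of_eq (posSemidef_contract hΘ hΦ
    (fun (p : A'.out.idx × A'.inp.idx) (s : A.inp.idx × A.out.idx) => ((p.1, s.1), (p.2, s.2)))
    (fun _ s => (s.2, s.1))) ?_
  ext p q
  rw [SuperMap.choi_act_apply]
  simp only [Matrix.of_apply, Fintype.sum_prod_type]

/-- Exhibits the Choi matrix as a contraction over the ancilla, the form in which positivity and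
partial traces can be read off. -/
theorem choi_concat_apply {R : QSystem.{u}} (pre : LMap A'.inp.idx (R.idx × A.inp.idx))
    (post : LMap (R.idx × A.out.idx) A'.out.idx)
    (p q : (A'.out.idx × A.inp.idx) × (A'.inp.idx × A.out.idx)) :
    choi (concat pre post) p q = ∑ r, ∑ r', choi pre ((r, p.1.2), p.2.1) ((r', q.1.2), q.2.1) *
      choi post (p.1.1, (r, p.2.2)) (q.1.1, (r', q.2.2)) := by
  have hpre : ∀ (r r' : R.idx) (x x' : A.out.idx),
      tensorId pre A.out.idx (Matrix.single p.2 q.2 1) ((r, p.1.2), x) ((r', q.1.2), x')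
        = if x = p.2.2 ∧ x' = q.2.2 then choi pre ((r, p.1.2), p.2.1) ((r', q.1.2), q.2.1)
          else 0 := by
    intro r r' x x'
    rw [choi_apply]
    have : (Matrix.of fun a a' => (Matrix.single p.2 q.2 (1 : ℂ)) (a, x) (a', x'))
        = if x = p.2.2 ∧ x' = q.2.2 then Matrix.single p.2.1 q.2.1 1 else 0 := by
      ext a a'
      split_ifs with h
      · obtain ⟨rfl, rfl⟩ := h
        simp [Matrix.single_apply, Prod.ext_iff]
      · simp only [Matrix.of_apply, Matrix.single_apply, Prod.ext_iff, Matrix.zero_apply]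
        rw [if_neg]
        rintro ⟨h1, h2⟩
        exact h ⟨h1.2.symm, h2.2.symm⟩
    simp only [tensorId, LinearMap.coe_mk, AddHom.coe_mk, Matrix.of_apply, this]
    split_ifs <;> simp
  rw [choi_apply]
  simp only [concat, LinearMap.comp_apply, LinearEquiv.coe_coe, Matrix.coe_reindexLinearEquiv]
  rw [tensorId_apply]
  simp only [Matrix.reindex_apply, Matrix.submatrix_apply, Fintype.sum_prod_type, swapRight,
    Equiv.coe_fn_symm_mk, hpre]
  refine Finset.sum_congr rfl fun r _ => ?_
  rw [Finset.sum_eq_single p.2.2 (by intro x _ hx; simp [hx]) (by simp)]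
  refine Finset.sum_congr rfl fun r' _ => ?_
  rw [Finset.sum_eq_single q.2.2 (by intro x _ hx; simp [hx]) (by simp)]
  simp

theorem IsSuperchannel.posSemidef_choi {Θ : SuperMap A A'} (h : IsSuperchannel Θ) :
    (choi Θ).PosSemidef := by
  obtain ⟨R, pre, post, hpre, hpost, rfl⟩ := h
  refine posSemidef_of_eq (posSemidef_contract (isChannel_iff.1 hpre).1 (isChannel_iff.1 hpost).1
    (fun (p : (A'.out.idx × A.inp.idx) × (A'.inp.idx × A.out.idx)) r => ((r, p.1.2), p.2.1))
    (fun p r => (p.1.1, (r, p.2.2)))) ?_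
  ext p q
  rw [choi_concat_apply]
  rfl

/-- The partial trace of a superchannel over its final output is the identity on the output of the
transformed channel, tensored with a channel. -/
theorem IsSuperchannel.exists_partialTrace {Θ : SuperMap A A'} (h : IsSuperchannel Θ) :
    ∃ N : A'.inp.idx → A'.inp.idx → Op A.inp.idx,
      (∀ a₀ a₁ b₀ b₁ x y, ∑ z, choi Θ ((z, a₀), (x, a₁)) ((z, b₀), (y, b₁))
        = N x y a₀ b₀ * (1 : Op A.out.idx) a₁ b₁) ∧
      ∀ x y, (N x y).trace = (1 : Op A'.inp.idx) x y := by
  obtain ⟨R, pre, post, hpre, hpost, rfl⟩ := h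
  refine ⟨fun x y => Matrix.of fun a₀ b₀ => ∑ r, choi pre ((r, a₀), x) ((r, b₀), y),
    fun a₀ a₁ b₀ b₁ x y => ?_, fun x y => ?_⟩
  · simp only [choi_concat_apply, Matrix.of_apply, Finset.sum_mul]
    rw [Finset.sum_comm]
    refine Finset.sum_congr rfl fun r _ => ?_
    rw [Finset.sum_comm]
    have : ∀ r', ∑ z, choi post (z, (r, a₁)) (z, (r', b₁))
        = (1 : Op (R.idx × A.out.idx)) (r, a₁) (r', b₁) := fun r' => by
      rw [← (isChannel_iff.1 hpost).2]; rfl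
    simp only [← Finset.mul_sum, this]
    rw [Finset.sum_eq_single r (by intro x _ hx; simp [hx.symm]) (by simp)]
    simp [Matrix.one_apply]
  · rw [← (isChannel_iff.1 hpre).2]
    simp only [Matrix.trace, Matrix.diag, Matrix.of_apply, outTrace, Fintype.sum_prod_type]
    rw [Finset.sum_comm]

/-- The trace depends only on the dimensions, which bounds all entries and makes the closure of F(A,
A') compact. -/
theorem IsSuperchannel.trace_choi {Θ : SuperMap A A'} (h : IsSuperchannel Θ) :
    (choi Θ).trace = Fintype.card A'.inp.idx * Fintype.card A.out.idx := by
  obtain ⟨N, hN, hN1⟩ := h.exists_partialTrace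
  simp only [Matrix.trace, Matrix.diag, Fintype.sum_prod_type]
  rw [Finset.sum_comm]
  have h1 : ∀ a₀, ∑ z, ∑ x, ∑ a₁, choi Θ ((z, a₀), (x, a₁)) ((z, a₀), (x, a₁))
      = Fintype.card A.out.idx * ∑ x, N x x a₀ a₀ := fun a₀ => by
    rw [Finset.sum_comm, Finset.mul_sum]
    refine Finset.sum_congr rfl fun x _ => ?_
    rw [Finset.sum_comm]
    simp [hN]
  simp only [h1, ← Finset.mul_sum]
  rw [Finset.sum_comm]
  have h2 : ∀ x, ∑ a₀, N x x a₀ a₀ = 1 := fun x => by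
    have := hN1 x x
    rwa [Matrix.one_apply_eq] at this
  simp [h2, mul_comm]

/-- Tracing out the final output leaves N ⊗ 1 with 1 on A₁. Trace preservation of Φ then eliminates
Φ, and the trace of N remains. -/
theorem IsSuperchannel.isChannel_act {Θ : SuperMap A A'} (h : IsSuperchannel Θ) {Φ : A.Map}
    (hΦ : IsChannel Φ) : IsChannel (SuperMap.act Θ Φ) := by
  rw [isChannel_iff] at hΦ ⊢
  refine ⟨SuperMap.posSemidef_choi_act h.posSemidef_choi hΦ.1, ?_⟩
  obtain ⟨N, hN, hN1⟩ := h.exists_partialTrace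
  ext x y
  rw [← hN1]
  simp only [outTrace, Matrix.of_apply, SuperMap.choi_act_apply]
  rw [Finset.sum_comm, Matrix.trace]
  refine Finset.sum_congr rfl fun a₀ _ => ?_
  have h1 : ∀ b₀, ∑ a₁, ∑ b₁, ∑ z, choi Θ ((z, a₀), (x, a₁)) ((z, b₀), (y, b₁)) *
      choi Φ (a₁, a₀) (b₁, b₀) = N x y a₀ b₀ * (1 : Op A.inp.idx) a₀ b₀ := fun b₀ => by
    rw [← hΦ.2, outTrace, Matrix.of_apply, Finset.mul_sum]
    refine Finset.sum_congr rfl fun a₁ _ => ?_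
    simp only [← Finset.sum_mul, hN]
    simp [Matrix.one_apply]
  have h2 : ∑ z, ∑ a₁, ∑ b₀, ∑ b₁, choi Θ ((z, a₀), (x, a₁)) ((z, b₀), (y, b₁)) *
      choi Φ (a₁, a₀) (b₁, b₀) = ∑ b₀, ∑ a₁, ∑ b₁, ∑ z,
        choi Θ ((z, a₀), (x, a₁)) ((z, b₀), (y, b₁)) * choi Φ (a₁, a₀) (b₁, b₀) := by
    symm
    rw [Finset.sum_congr rfl fun b₀ _ => Finset.sum_congr rfl fun a₁ _ => Finset.sum_comm,
      Finset.sum_congr rfl fun b₀ _ => Finset.sum_comm, Finset.sum_comm]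
    exact Finset.sum_congr rfl fun z _ => Finset.sum_comm
  rw [h2]
  simp [h1, Matrix.one_apply]

/-- Pairing with the action of a supermap is pairing with the supermap. -/
theorem pairing_act (ρ : Op (A'.inp.idx × A'.out.idx)) (Θ : SuperMap A A') (Φ : A.Map) :
    pairing ρ (SuperMap.act Θ Φ) = pairing (linkChoi ρ Φ) Θ := by
  rw [pairing_eq_dotRe, pairing_eq_dotRe, dotRe, dotRe]
  congr 1
  let e : (A'.out.idx × A'.inp.idx) × (A.inp.idx × A.out.idx) ≃
    (A'.out.idx × A.inp.idx) × (A'.inp.idx × A.out.idx) := Equiv.prodProdProdComm _ _ _ _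
  have he : ∀ G : (A'.out.idx × A.inp.idx) × (A'.inp.idx × A.out.idx) → ℂ,
      ∑ x, G x = ∑ p, ∑ s, G (e (p, s)) := fun G => by
    rw [← e.sum_comp, Fintype.sum_prod_type]
  rw [he]
  refine Finset.sum_congr rfl fun p _ => ?_
  simp only [he]
  rw [Finset.sum_comm]
  refine Finset.sum_congr rfl fun q _ => ?_
  rw [SuperMap.choi_act_apply]
  simp only [Finset.mul_sum, Fintype.sum_prod_type]
  refine Finset.sum_congr rfl fun a₀ _ => Finset.sum_congr rfl fun a₁ _ =>
    Finset.sum_congr rfl fun b₀ _ => Finset.sum_congr rfl fun b₁ _ => ?_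
  simp [linkChoi, e, Prod.swap]
  ring

end Superchannel

/-! ### Upper bounds for the dual norm and the diamond norm -/

section Bounds

variable {α β : Type*} [Fintype α] [DecidableEq α] [Fintype β] [DecidableEq β]

theorem PosSemidef.dotRe_le {ι : Type*} [Fintype ι] (X : Op ι) {C : Op ι} (hC : C.PosSemidef) :
    dotRe X C ≤ (∑ p, ∑ q, ‖X p q‖) * C.trace.re := by
  refine (Complex.re_le_norm _).trans ((norm_sum_le _ _).trans ?_)
  rw [Finset.sum_mul]
  refine Finset.sum_le_sum fun p _ => (norm_sum_le _ _).trans ?_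
  rw [Finset.sum_mul]
  refine Finset.sum_le_sum fun q _ => ?_
  rw [norm_mul]
  exact mul_le_mul_of_nonneg_left (PosSemidef.norm_apply_le hC p q) (norm_nonneg _)

theorem IsChannel.trace_choi {α β : Type*} [Fintype α] [DecidableEq α] [Fintype β]
    {Φ : LMap α β} (hΦ : IsChannel Φ) : (choi Φ).trace = Fintype.card α := by
  rw [← trace_outTrace, (isChannel_iff.1 hΦ).2, Matrix.trace_one]

theorem pairing_le_pairing {ρ : Op (α × β)} (hρ : ρ.PosSemidef) {φ χ : LMap α β}
    (h : (choi χ - choi φ).PosSemidef) : pairing ρ φ ≤ pairing ρ χ := by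
  simp only [pairing_eq_dotRe]
  exact dotRe_le_dotRe (hρ.submatrix _) h

theorem pairing_le_dualDiamondNorm {ρ : Op (α × β)} (hρ : ρ.PosSemidef) {χ : LMap α β}
    (hχ : IsChannel χ) : pairing ρ χ ≤ dualDiamondNorm ρ := by
  -- Boundedness has to be shown, as a real `sSup` defaults to 0 otherwise; it holds because all
  -- these Choi matrices have trace `card α`. The competitor is φ = χ.
  refine le_csSup ⟨(∑ p, ∑ q, ‖ρ.submatrix Prod.swap Prod.swap p q‖) * Fintype.card α, ?_⟩
    ⟨χ, χ, hχ, ?_, ?_, rfl⟩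
  · rintro t ⟨φ, χ, hχ, h1, -, rfl⟩
    rw [isCP_iff, choi_sub] at h1
    refine (pairing_le_pairing hρ h1).trans ?_
    rw [pairing_eq_dotRe]
    refine (PosSemidef.dotRe_le _ (isChannel_iff.1 hχ).1).trans_eq ?_
    rw [hχ.trace_choi, Complex.natCast_re]
  · rw [isCP_iff, sub_self, ← sub_self χ, choi_sub, sub_self]
    exact .zero
  · rw [isCP_iff, choi_add]
    exact (isChannel_iff.1 hχ).1.add (isChannel_iff.1 hχ).1

/-- Weak duality: φ ≤ χ and ρ ≤ 1 ⊗ σ, while pairing 1 ⊗ σ with the Choi matrix of a channel gives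
exactly the trace of σ. -/
theorem dualDiamondNorm_le {ρ : Op (α × β)} (hρ : ρ.PosSemidef) {σ : Op α} (hσ : σ.PosSemidef)
    (h : ((1 : Op β) ⊗ₖ σ - ρ.submatrix Prod.swap Prod.swap).PosSemidef) :
    dualDiamondNorm ρ ≤ σ.trace.re := by
  refine Real.sSup_le ?_ (Complex.nonneg_iff.1 hσ.trace_nonneg).1
  rintro t ⟨φ, χ, hχ, h1, -, rfl⟩
  rw [isCP_iff, choi_sub] at h1
  refine (pairing_le_pairing hρ h1).trans ?_
  obtain ⟨h2, h3⟩ := isChannel_iff.1 hχ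
  rw [pairing_eq_dotRe, dotRe_comm]
  refine (dotRe_le_dotRe h2 h).trans_eq ?_
  rw [dotRe_comm, dotRe_one_kronecker, h3, dotRe_one]

/-- Applying the dominating map to ω bounds the traceless difference of the outputs by c times the
state (χ ⊗ id)(ω). -/
theorem IsChannel.traceNorm_tensorId_sub_le {Φ Ψ χ : LMap α β} (hΦ : IsChannel Φ)
    (hΨ : IsChannel Ψ) (hχ : IsChannel χ) {c : ℝ} (hc : 0 ≤ c)
    (h : (c • choi χ - (choi Φ - choi Ψ)).PosSemidef) {κ : Type*} [Fintype κ] [DecidableEq κ]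
    {ω : Op (α × κ)} (hω : IsState ω) : traceNorm (tensorId (Φ - Ψ) κ ω) ≤ 2 * c := by
  have h1 := hΦ.isState_tensorId hω
  have h2 := hΨ.isState_tensorId hω
  refine traceNorm_le_of_le_smul ?_ ?_ (hχ.isState_tensorId hω) hc ?_
  · rw [tensorId_sub]
    exact h1.1.isHermitian.sub h2.1.isHermitian
  · rw [tensorId_sub, Matrix.trace_sub, h1.2, h2.2, sub_self]
  · have h3 : (choi (c • χ - (Φ - Ψ))).PosSemidef := by
      rwa [choi_sub, choi_sub, choi_smul]
    have h4 := posSemidef_tensorId h3 hω.1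
    refine posSemidef_of_eq h4 ?_
    rw [tensorId_sub]
    congr 1

/-- Domination of a difference of channels by a multiple of a channel bounds its diamond norm. -/
theorem IsChannel.diamondNorm_sub_le {Φ Ψ χ : LMap α β} (hΦ : IsChannel Φ)
    (hΨ : IsChannel Ψ) (hχ : IsChannel χ) {c : ℝ} (hc : 0 ≤ c)
    (h : (c • choi χ - (choi Φ - choi Ψ)).PosSemidef) : diamondNorm (Ψ - Φ) ≤ 2 * c := by
  refine Real.sSup_le ?_ (by positivity)
  rintro t ⟨ω, hω, rfl⟩
  rw [← neg_sub Φ Ψ, ← zero_sub (Φ - Ψ), tensorId_sub]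
  have : tensorId (0 : LMap α β) α ω = 0 := by ext; simp [tensorId]
  rw [this, zero_sub, traceNorm_neg]
  exact hΦ.traceNorm_tensorId_sub_le hΨ hχ hc h hω

theorem IsChannel.traceNorm_le_diamondNorm {Φ Ψ : LMap α β} (hΦ : IsChannel Φ)
    (hΨ : IsChannel Ψ) {ω : Op (α × α)} (hω : IsState ω) :
    traceNorm (tensorId (Φ - Ψ) α ω) ≤ diamondNorm (Ψ - Φ) := by
  have key : ∀ ω : Op (α × α), traceNorm (tensorId (Ψ - Φ) α ω)
      = traceNorm (tensorId (Φ - Ψ) α ω) := fun ω => by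
    rw [tensorId_sub, tensorId_sub, ← neg_sub, traceNorm_neg]
  -- The supremum is over a bounded set: Φ − Ψ is dominated by Φ itself, so c = 1 works.
  refine le_csSup ⟨2 * 1, ?_⟩ ⟨ω, hω, (key ω).symm⟩
  rintro t ⟨ω, hω, rfl⟩
  rw [key]
  refine hΦ.traceNorm_tensorId_sub_le hΨ hΦ zero_le_one ?_ hω
  rw [one_smul, sub_sub_cancel]
  exact (isChannel_iff.1 hΨ).1

end Bounds

/-! ### Open cones and linear functionals for the separation argument -/

section Separation

variable {ι : Type*} [Fintype ι]

/-- The matrices with strictly positive hermitian part. -/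
def strictPos (ι : Type*) [Fintype ι] : Set (Op ι) :=
  {M | ∀ z : ι → ℂ, z ≠ 0 → 0 < dotRe M (Matrix.vecMulVec z (star z))}

/-- Only the hermitian part is constrained, so openness holds among all matrices. Compactness of the
unit sphere makes strict positivity uniform, and homogeneity extends it to all vectors. -/
theorem isOpen_strictPos : IsOpen (strictPos ι) := by
  rw [isOpen_iff_mem_nhds]
  intro M hM
  have hc : Continuous fun p : Op ι × (ι → ℂ) =>
      dotRe p.1 (Matrix.vecMulVec p.2 (star p.2)) := by
    simp only [dotRe, Matrix.vecMulVec_apply, Pi.star_apply]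
    fun_prop
  have hev := (isCompact_sphere (0 : ι → ℂ) 1).eventually_forall_of_forall_eventually (x₀ := M)
    (P := fun M z => 0 < dotRe M (Matrix.vecMulVec z (star z))) fun z hz =>
      (hc.tendsto (M, z)).eventually_const_lt (hM z (by rintro rfl; simp at hz))
  filter_upwards [hev] with N hN z hz
  have hz' : 0 < ‖z‖ := norm_pos_iff.2 hz
  have h1 := hN (‖z‖⁻¹ • z) (by simp [norm_smul, hz'.ne'])
  have h2 : Matrix.vecMulVec (‖z‖⁻¹ • z) (star (‖z‖⁻¹ • z))
      = (‖z‖⁻¹ ^ 2) • Matrix.vecMulVec z (star z) := by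
    ext p q
    simp [Matrix.vecMulVec_apply]
    ring
  rw [h2, dotRe_smul] at h1
  exact (pos_iff_pos_of_mul_pos h1).1 (by positivity)

theorem smul_add_smul_mem_strictPos {M N : Op ι} (hM : M ∈ strictPos ι) (hN : N ∈ strictPos ι)
    {a b : ℝ} (ha : 0 ≤ a) (hb : 0 ≤ b) (hab : a + b = 1) : a • M + b • N ∈ strictPos ι := by
  intro z hz
  rw [add_dotRe, smul_dotRe, smul_dotRe]
  have h1 := hM z hz
  have h2 := hN z hz
  rcases ha.eq_or_lt with rfl | ha
  · rw [zero_add] at hab; subst hab; linarith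
  · have := mul_pos ha h1
    have := mul_nonneg hb h2.le
    linarith

theorem smul_mem_strictPos {M : Op ι} (hM : M ∈ strictPos ι) {c : ℝ} (hc : 0 < c) :
    c • M ∈ strictPos ι := fun z hz => by
  rw [smul_dotRe]; exact mul_pos hc (hM z hz)

theorem PosSemidef.add_smul_one_mem_strictPos [DecidableEq ι] {M : Op ι} (hM : M.PosSemidef)
    {η : ℝ} (hη : 0 < η) : M + η • (1 : Op ι) ∈ strictPos ι := by
  intro z hz
  rw [add_dotRe, smul_dotRe]
  have hv : (Matrix.vecMulVec z (star z)).PosSemidef := Matrix.posSemidef_vecMulVec_self_star z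
  have h0 : Matrix.vecMulVec z (star z) ≠ 0 := by
    obtain ⟨i, hi⟩ := Function.ne_iff.1 hz
    intro h
    have := congrFun (congrFun h i) i
    simp [Matrix.vecMulVec_apply] at this
    exact hi this
  rw [dotRe_comm 1, dotRe_one]
  have := mul_pos hη (PosSemidef.trace_re_pos hv h0)
  linarith [dotRe_nonneg hM hv]

theorem posSemidef_of_mem_strictPos {M : Op ι} (hM : M ∈ strictPos ι) (h : M.IsHermitian) :
    M.PosSemidef := by
  refine posSemidef_of_dotRe_nonneg h fun z => ?_
  rcases eq_or_ne z 0 with rfl | hz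
  · simp [dotRe]
  · exact (hM z hz).le

/-- Real linear functionals on hermitian matrices are represented by hermitian matrices. -/
theorem exists_isHermitian_forall_eq_dotRe (f : Op ι →ₗ[ℝ] ℝ) :
    ∃ G : Op ι, G.IsHermitian ∧ ∀ X : Op ι, X.IsHermitian → f X = dotRe G X := by
  classical
  -- Chosen so that the real part of G p q · x recovers f on both the real and the imaginary part of
  -- the entry x.
  let G : Op ι := Matrix.of fun p q =>
    (f (Matrix.single p q 1) : ℂ) - Complex.I * f (Matrix.single p q Complex.I)
  have h1 : ∀ X, f X = dotRe G X := fun X => by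
    conv_lhs => rw [Matrix.matrix_eq_sum_single X]
    simp only [map_sum, dotRe, Complex.re_sum]
    refine Finset.sum_congr rfl fun p _ => Finset.sum_congr rfl fun q _ => ?_
    have : Matrix.single p q (X p q) = (X p q).re • Matrix.single p q (1 : ℂ)
        + (X p q).im • Matrix.single p q Complex.I := by
      rw [Matrix.smul_single, Matrix.smul_single, ← Matrix.single_add]
      congr 1
      simp [Complex.re_add_im]
    rw [this, map_add, map_smul, map_smul]
    simp [G]
    ring
  -- Hermitian X cannot tell G from its adjoint, so G may be averaged with it.
  have h2 : ∀ X : Op ι, X.IsHermitian → dotRe G.conjTranspose X = dotRe G X := fun X hX => by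
    have : ∑ p, ∑ q, G.conjTranspose p q * X p q = star (∑ p, ∑ q, G p q * X p q) := by
      rw [Finset.sum_comm]
      simp only [star_sum, star_mul']
      refine Finset.sum_congr rfl fun p _ => Finset.sum_congr rfl fun q _ => ?_
      rw [Matrix.conjTranspose_apply, hX.apply]
    rw [dotRe, this]
    simp [dotRe]
  refine ⟨(2⁻¹ : ℝ) • (G + G.conjTranspose), isHermitian_real_smul ?_ _, fun X hX => ?_⟩
  · rw [Matrix.IsHermitian, Matrix.conjTranspose_add, Matrix.conjTranspose_conjTranspose, add_comm]
  · rw [smul_dotRe, add_dotRe, h2 X hX, h1]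
    ring

end Separation

/-! ### The theorem of the alternative for domination -/

section Alternative

variable {α β : Type*} [Fintype α] [DecidableEq α] [Fintype β] [DecidableEq β]

/-- A subnormalised positive operator can be completed to the Choi matrix of a channel. -/
theorem exists_isChannel_of_outTrace_le [Nonempty β] {Q : Op (β × α)} (hQ : Q.PosSemidef) {t : ℝ}
    (ht : 0 < t) (h : (t • (1 : Op α) - outTrace Q).PosSemidef) :
    ∃ χ : LMap α β, IsChannel χ ∧ (t • choi χ - Q).PosSemidef := by
  set T := t • (1 : Op α) - outTrace Q with hT
  have h1 : ((1 : Op β) ⊗ₖ ((Fintype.card β : ℝ)⁻¹ • T)).PosSemidef :=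
    Matrix.PosSemidef.one.kronecker (posSemidef_real_smul h (by positivity))
  -- The missing part T of the normalisation is filled in with a maximally mixed output.
  refine ⟨ofChoi (t⁻¹ • (Q + (1 : Op β) ⊗ₖ ((Fintype.card β : ℝ)⁻¹ • T))), ?_, ?_⟩
  · rw [isChannel_iff, choi_ofChoi]
    refine ⟨posSemidef_real_smul (hQ.add h1) (by positivity), ?_⟩
    rw [outTrace_smul, outTrace_add, outTrace_one_kronecker, smul_smul,
      mul_inv_cancel₀ (by positivity), one_smul, hT, add_sub_cancel, smul_smul,
      inv_mul_cancel₀ ht.ne', one_smul]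
  · rw [choi_ofChoi, smul_smul, mul_inv_cancel₀ ht.ne', one_smul, add_sub_cancel_left]
    exact h1

/-- Either some element of a convex set of hermitian operators is dominated by `t` times a channel,
or there is a dual witness against this. -/
theorem exists_dominated_or_exists_witness [Nonempty β] {K : Set (Op (β × α))}
    (hK : Convex ℝ K) (hne : K.Nonempty) (hherm : ∀ k ∈ K, k.IsHermitian) {t : ℝ} (ht : 0 < t) :
    (∃ k ∈ K, ∃ χ : LMap α β, IsChannel χ ∧ (t • choi χ - k).PosSemidef) ∨
    ∃ ρ : Op (β × α), ρ.PosSemidef ∧ ∃ σ : Op α, IsState σ ∧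
      ((1 : Op β) ⊗ₖ σ - ρ).PosSemidef ∧ ∀ k ∈ K, t ≤ dotRe ρ k := by
  -- An open convex cone of pairs (X, Y) with X < Q and Tr_out Q < Y for some Q ≥ 0. A common point
  -- with K × {t·1} is a k ∈ K below such a Q, which completes to t times a channel.
  let U : Set (Op (β × α) × Op α) := {x | ∃ Q : Op (β × α), Q.PosSemidef ∧
    Q - x.1 ∈ strictPos (β × α) ∧ x.2 - outTrace Q ∈ strictPos α}
  have hUo : IsOpen U := by
    have : U = ⋃ Q ∈ {Q : Op (β × α) | Q.PosSemidef}, {x : Op (β × α) × Op α |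
        Q - x.1 ∈ strictPos (β × α) ∧ x.2 - outTrace Q ∈ strictPos α} := by
      ext x; simp [U, and_left_comm]
    rw [this]
    refine isOpen_biUnion fun Q _ => IsOpen.inter ?_ ?_
    · exact isOpen_strictPos.preimage (f := fun x : Op (β × α) × Op α => Q - x.1)
        (continuous_const.sub continuous_fst)
    · exact isOpen_strictPos.preimage (f := fun x : Op (β × α) × Op α => x.2 - outTrace Q)
        (continuous_snd.sub continuous_const)
  have hUc : Convex ℝ U := by
    rintro x ⟨P, hP, hP1, hP2⟩ y ⟨Q, hQ, hQ1, hQ2⟩ a b ha hb hab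
    refine ⟨a • P + b • Q, (posSemidef_real_smul hP ha).add (posSemidef_real_smul hQ hb), ?_, ?_⟩
    · have := smul_add_smul_mem_strictPos hP1 hQ1 ha hb hab
      convert this using 1
      simp only [Prod.fst_add, Prod.smul_fst, smul_sub]
      abel
    · have := smul_add_smul_mem_strictPos hP2 hQ2 ha hb hab
      convert this using 1
      simp only [Prod.snd_add, Prod.smul_snd, smul_sub, outTrace_add, outTrace_smul]
      abel
  by_cases hdis : Disjoint U (K ×ˢ {t • (1 : Op α)})
  swap
  · left
    obtain ⟨⟨k, y⟩, ⟨Q, hQ, hQ1, hQ2⟩, hk, hy⟩ := Set.not_disjoint_iff.1 hdis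
    simp only [Set.mem_singleton_iff] at hy hk hQ1 hQ2
    subst hy
    have h1 := posSemidef_of_mem_strictPos hQ1 (hQ.isHermitian.sub (hherm k hk))
    have h2 := posSemidef_of_mem_strictPos hQ2 ((isHermitian_real_smul Matrix.isHermitian_one t).sub
      (outTrace_isHermitian hQ.isHermitian))
    obtain ⟨χ, hχ, h3⟩ := exists_isChannel_of_outTrace_le hQ ht h2
    refine ⟨k, hk, χ, hχ, ?_⟩
    have := h3.add h1
    rwa [sub_add_sub_cancel] at this
  right
  obtain ⟨f, s, hfU, hfK⟩ := geometric_hahn_banach_open hUc hUo (hK.prod (convex_singleton _)) hdis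
  -- On hermitian pairs f(X, Y) = ⟨ρ, X⟩ − ⟨σ, Y⟩; the sign is chosen so that σ comes out positive.
  obtain ⟨ρ, hρ, hfρ⟩ := exists_isHermitian_forall_eq_dotRe
    ((f : Op (β × α) × Op α →ₗ[ℝ] ℝ) ∘ₗ LinearMap.inl ℝ _ _)
  obtain ⟨σ, hσ, hfσ⟩ := exists_isHermitian_forall_eq_dotRe
    (-((f : Op (β × α) × Op α →ₗ[ℝ] ℝ) ∘ₗ LinearMap.inr ℝ _ _))
  have hf : ∀ X : Op (β × α), ∀ Y : Op α, X.IsHermitian → Y.IsHermitian →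
      f (X, Y) = dotRe ρ X - dotRe σ Y := fun X Y hX hY => by
    rw [← hfρ X hX, ← hfσ Y hY]
    simp [← map_add]
  have hUsmul : ∀ x ∈ U, ∀ c : ℝ, 0 < c → c • x ∈ U := by
    rintro x ⟨Q, hQ, hQ1, hQ2⟩ c hc
    refine ⟨c • Q, posSemidef_real_smul hQ hc.le, ?_, ?_⟩
    · have := smul_mem_strictPos hQ1 hc
      rwa [smul_sub] at this
    · have := smul_mem_strictPos hQ2 hc
      rwa [smul_sub, ← outTrace_smul] at this
  have hU0 : ((-1 : Op (β × α)), (1 : Op α)) ∈ U := by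
    refine ⟨0, .zero, ?_, ?_⟩
    · have := PosSemidef.add_smul_one_mem_strictPos (ι := β × α) .zero one_pos
      simpa using this
    · have := PosSemidef.add_smul_one_mem_strictPos (ι := α) .zero one_pos
      have h0 : outTrace (0 : Op (β × α)) = 0 := by ext; simp [outTrace]
      simpa [h0] using this
  -- Scaling a point of the cone towards 0 makes f arbitrarily small there, so a negative upper
  -- bound is impossible.
  have hs : 0 ≤ s := by
    by_contra! hs
    have h1 : ∀ c : ℝ, 0 < c → c * f (-1, 1) < s := fun c hc => by
      have := hfU _ (hUsmul _ hU0 c hc)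
      rwa [map_smul] at this
    have h2 : f (-1, 1) < 0 := by linarith [h1 1 one_pos]
    have := h1 (s / (2 * f (-1, 1))) (by apply div_pos_of_neg_of_neg hs; linarith)
    rw [div_mul_eq_mul_div, div_lt_iff_of_neg (by linarith)] at this
    nlinarith
  have hneg : ∀ x ∈ U, f x ≤ 0 := fun x hx => by
    by_contra! h
    have := hfU _ (hUsmul x hx ((s + 1) / f x) (by positivity))
    rw [map_smul, smul_eq_mul, div_mul_cancel₀ _ h.ne'] at this
    linarith
  -- The inequality f ≤ 0 passes to non-strict pairs by perturbing with η·1 and letting η → 0.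
  -- Varying Z, W and Q separately then gives ρ ≥ 0, σ ≥ 0 and ρ ≤ 1 ⊗ σ.
  have hkey : ∀ (Q Z : Op (β × α)) (W : Op α), Q.PosSemidef → Z.PosSemidef → W.PosSemidef →
      dotRe ρ (Q - Z) ≤ dotRe σ (outTrace Q + W) := by
    intro Q Z W hQ hZ hW
    have h1 : ∀ η : ℝ, 0 < η → dotRe ρ (Q - Z) - dotRe σ (outTrace Q + W)
        ≤ η * (dotRe ρ 1 + dotRe σ 1) := fun η hη => by
      have hη1 := isHermitian_real_smul (Matrix.isHermitian_one (n := β × α) (α := ℂ)) η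
      have hη2 := isHermitian_real_smul (Matrix.isHermitian_one (n := α) (α := ℂ)) η
      have := hneg (Q - (Z + η • 1), outTrace Q + (W + η • 1)) ⟨Q, hQ, by
        simpa using PosSemidef.add_smul_one_mem_strictPos hZ hη, by
        simpa using PosSemidef.add_smul_one_mem_strictPos hW hη⟩
      rw [hf _ _ (hQ.isHermitian.sub (hZ.isHermitian.add hη1))
        ((outTrace_isHermitian hQ.isHermitian).add (hW.isHermitian.add hη2))] at this
      simp only [dotRe_add, dotRe_sub, dotRe_smul] at this ⊢
      linarith
    have h2 : Filter.Tendsto (fun η : ℝ => η * (dotRe ρ 1 + dotRe σ 1))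
        (nhdsWithin 0 (Set.Ioi 0)) (nhds (0 * (dotRe ρ 1 + dotRe σ 1))) :=
      ((continuous_id.mul continuous_const).tendsto 0).mono_left nhdsWithin_le_nhds
    have := ge_of_tendsto h2 (eventually_nhdsWithin_of_forall h1)
    linarith
  have hz : outTrace (0 : Op (β × α)) = 0 := by ext; simp [outTrace]
  have hρ' : ρ.PosSemidef := posSemidef_of_dotRe_nonneg hρ fun z => by
    have := hkey 0 _ 0 .zero (Matrix.posSemidef_vecMulVec_self_star z) .zero
    rw [hz, add_zero, dotRe_sub, dotRe_comm ρ 0] at this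
    simp [dotRe] at this ⊢
    linarith
  have hσ' : σ.PosSemidef := posSemidef_of_dotRe_nonneg hσ fun z => by
    have := hkey 0 0 _ .zero .zero (Matrix.posSemidef_vecMulVec_self_star z)
    rw [hz, zero_add, sub_zero] at this
    refine le_trans ?_ this
    simp [dotRe]
  have hle : ((1 : Op β) ⊗ₖ σ - ρ).PosSemidef := by
    refine posSemidef_of_dotRe_nonneg ?_ fun z => ?_
    · exact (Matrix.PosSemidef.one.kronecker hσ').isHermitian.sub hρ
    · have := hkey _ 0 0 (Matrix.posSemidef_vecMulVec_self_star z) .zero .zero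
      rw [sub_zero, add_zero] at this
      rw [sub_dotRe, dotRe_one_kronecker]
      linarith
  have hval : ∀ k ∈ K, t * σ.trace.re ≤ dotRe ρ k := fun k hk => by
    have := hfK (k, t • 1) ⟨hk, rfl⟩
    rw [hf _ _ (hherm k hk) (isHermitian_real_smul Matrix.isHermitian_one t), dotRe_smul,
      dotRe_one] at this
    linarith
  -- If σ = 0 then 0 ≤ ρ ≤ 0, so f vanishes on hermitian pairs; this contradicts strict separation,
  -- as K is nonempty.
  have hσ0 : σ ≠ 0 := by
    rintro rfl
    rw [Matrix.kronecker_zero, zero_sub] at hle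
    have h1 := (Complex.nonneg_iff.1 hle.trace_nonneg).1
    have h2 : ρ = 0 := by
      by_contra h
      have := PosSemidef.trace_re_pos hρ' h
      rw [Matrix.trace_neg, Complex.neg_re] at h1
      linarith
    obtain ⟨k, hk⟩ := hne
    have h3 := hfU _ hU0
    have h4 := hfK (k, t • 1) ⟨hk, rfl⟩
    rw [hf _ _ (hherm k hk) (isHermitian_real_smul Matrix.isHermitian_one t)] at h4
    rw [hf _ _ Matrix.isHermitian_one.neg Matrix.isHermitian_one] at h3
    subst h2
    simp [dotRe] at h3 h4
    linarith
  have hpos := PosSemidef.trace_re_pos hσ' hσ0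
  refine ⟨(σ.trace.re)⁻¹ • ρ, posSemidef_real_smul hρ' (by positivity), (σ.trace.re)⁻¹ • σ,
    PosSemidef.isState_smul hσ' hσ0, ?_, fun k hk => ?_⟩
  · rw [Matrix.kronecker_smul, ← smul_sub]
    exact posSemidef_real_smul hle (by positivity)
  · rw [smul_dotRe, ← div_eq_inv_mul, le_div_iff₀ hpos]
    exact hval k hk

end Alternative

/-! ### Witnesses are bounded by half the diamond norm -/

section Duality

variable {α β : Type*} [Fintype α] [DecidableEq α] [Fintype β] [DecidableEq β]

theorem dotRe_choi_eq_dotRe_tensorId {α β : Type*} [Fintype α] [DecidableEq α] [Fintype β]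
    (Φ : LMap α β) {ρ P : Op (β × α)} (V : Op α)
    (hρ : ∀ b a b' a', ρ (b, a) (b', a')
      = ∑ k, ∑ k', V a k * P (b, k) (b', k') * star (V a' k')) :
    dotRe ρ (choi Φ) = dotRe P (tensorId Φ α (Matrix.vecMulVec (fun p : α × α => V p.1 p.2)
      (star fun p : α × α => V p.1 p.2))) := by
  have hswap : ∀ F : α → α → α → α → ℂ, ∑ a, ∑ a', ∑ k, ∑ k', F a a' k k'
      = ∑ k, ∑ k', ∑ a, ∑ a', F a a' k k' := fun F => by
    rw [Finset.sum_congr rfl fun a _ => Finset.sum_comm, Finset.sum_comm]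
    refine Finset.sum_congr rfl fun k _ => ?_
    rw [Finset.sum_congr rfl fun a _ => Finset.sum_comm, Finset.sum_comm]
  rw [dotRe, dotRe]
  simp only [Fintype.sum_prod_type, tensorId_apply, hρ, Finset.sum_mul, Finset.mul_sum]
  congr 1
  refine Finset.sum_congr rfl fun b _ => ?_
  rw [Finset.sum_comm]
  conv_rhs => rw [Finset.sum_comm]
  refine Finset.sum_congr rfl fun b' _ => ?_
  rw [hswap]
  refine Finset.sum_congr rfl fun k _ => Finset.sum_congr rfl fun k' _ =>
    Finset.sum_congr rfl fun a _ => Finset.sum_congr rfl fun a' _ => ?_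
  simp only [Matrix.vecMulVec_apply, Pi.star_apply]
  ring

/-- With σ = VV* and V invertible, P = (1 ⊗ V⁻¹)ρ(1 ⊗ V⁻¹)* satisfies 0 ≤ P ≤ 1. The pairing becomes
that of P with the output on ω = |V⟩⟩⟨⟨V|, whose trace is that of σ. -/
theorem dotRe_choi_sub_le_of_posDef {Φ Ψ : LMap α β} (hΦ : IsChannel Φ) (hΨ : IsChannel Ψ)
    [Nonempty α] {ρ : Op (β × α)} (hρ : ρ.PosSemidef) {σ : Op α} (hσ : σ.PosDef)
    (h : ((1 : Op β) ⊗ₖ σ - ρ).PosSemidef) :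
    dotRe ρ (choi Φ - choi Ψ) ≤ diamondNorm (Ψ - Φ) / 2 * σ.trace.re := by
  obtain ⟨V, hV, hσV⟩ := CStarAlgebra.isStrictlyPositive_iff_eq_mul_star_self.1
    (Matrix.isStrictlyPositive_iff_posDef.2 hσ)
  rw [Matrix.isUnit_iff_isUnit_det] at hV
  set W : Op α := V⁻¹ with hW
  have hWV : W * V = 1 := Matrix.nonsing_inv_mul V hV
  have hVW : V * W = 1 := Matrix.mul_nonsing_inv V hV
  set M' : Op (β × α) := (1 : Op β) ⊗ₖ W with hM'
  have hMM' : ((1 : Op β) ⊗ₖ V) * M' = 1 := by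
    rw [hM', ← Matrix.mul_kronecker_mul, one_mul, hVW, Matrix.one_kronecker_one]
  set P := M' * ρ * M'.conjTranspose with hPdef
  have hP : P.PosSemidef := hρ.mul_mul_conjTranspose_same M'
  have hP1 : (1 - P).PosSemidef := by
    refine posSemidef_of_eq (h.mul_mul_conjTranspose_same M') ?_
    rw [mul_sub, sub_mul, hσV, hM', Matrix.conjTranspose_kronecker, ← Matrix.mul_kronecker_mul,
      ← Matrix.mul_kronecker_mul, Matrix.conjTranspose_one, one_mul, one_mul, ← mul_assoc, hWV,
      one_mul, Matrix.star_eq_conjTranspose, ← Matrix.conjTranspose_mul, hWV,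
      Matrix.conjTranspose_one, Matrix.one_kronecker_one, hPdef, hM',
      Matrix.conjTranspose_kronecker, Matrix.conjTranspose_one]
  have hρP : ρ = ((1 : Op β) ⊗ₖ V) * P * ((1 : Op β) ⊗ₖ V).conjTranspose := by
    calc ρ = (((1 : Op β) ⊗ₖ V) * M') * ρ * (((1 : Op β) ⊗ₖ V) * M').conjTranspose := by
          rw [hMM']; simp
      _ = _ := by rw [Matrix.conjTranspose_mul, hPdef]; simp only [mul_assoc]
  have hρapp : ∀ b a b' a', ρ (b, a) (b', a')
      = ∑ k, ∑ k', V a k * P (b, k) (b', k') * star (V a' k') := fun b a b' a' => by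
    rw [hρP]
    simp only [Matrix.mul_apply, Fintype.sum_prod_type, Matrix.conjTranspose_apply,
      Matrix.kroneckerMap_apply, Matrix.one_apply, ite_mul, one_mul, zero_mul, Finset.sum_mul,
      apply_ite star, star_zero, mul_ite, mul_zero]
    rw [Finset.sum_eq_single b' (by intro x _ hx; simp [hx.symm]) (by simp)]
    simp only [if_true]
    conv_rhs => rw [Finset.sum_comm]
    refine Finset.sum_congr rfl fun k' _ => ?_
    rw [Finset.sum_eq_single b (by intro x _ hx; simp [hx.symm]) (by simp)]
    simp
  let v : α × α → ℂ := fun p => V p.1 p.2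
  set ω : Op (α × α) := Matrix.vecMulVec v (star v) with hω
  have hωp : ω.PosSemidef := Matrix.posSemidef_vecMulVec_self_star v
  have hωtr : ω.trace = σ.trace := by
    rw [hσV]
    simp [hω, v, Matrix.trace, Matrix.mul_apply, Fintype.sum_prod_type, Matrix.vecMulVec_apply]
  have hσ0 : 0 < σ.trace.re := (Complex.pos_iff.1 hσ.trace_pos).1
  have hω0 : ω ≠ 0 := by
    intro h0
    rw [← hωtr, h0] at hσ0
    simp at hσ0
  have hωs := PosSemidef.isState_smul hωp hω0
  rw [hωtr] at hωs
  have hH : dotRe ρ (choi Φ - choi Ψ) = dotRe P (tensorId (Φ - Ψ) α ω) := by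
    rw [← choi_sub]
    exact dotRe_choi_eq_dotRe_tensorId (Φ - Ψ) V hρapp
  have hsc : tensorId (Φ - Ψ) α ω
      = σ.trace.re • tensorId (Φ - Ψ) α ((σ.trace.re)⁻¹ • ω) := by
    ext p q
    simp only [tensorId_apply, Matrix.smul_apply, smul_mul_assoc, ← Finset.smul_sum, smul_smul]
    rw [mul_inv_cancel₀ hσ0.ne', one_smul]
  have h1 := hΦ.isState_tensorId hωs
  have h2 := hΨ.isState_tensorId hωs
  rw [hH, hsc, dotRe_smul, mul_comm]
  refine mul_le_mul_of_nonneg_right ?_ hσ0.le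
  refine (dotRe_le_half_traceNorm ?_ ?_ hP hP1).trans ?_
  · rw [tensorId_sub]
    exact h1.1.isHermitian.sub h2.1.isHermitian
  · rw [tensorId_sub, Matrix.trace_sub, h1.2, h2.2, sub_self]
  · have := hΦ.traceNorm_le_diamondNorm hΨ hωs
    linarith

/-- Replace σ by the invertible σ + η·1, which still dominates ρ and has trace 1 + η `card α`; then
let η → 0. -/
theorem dotRe_choi_sub_le {Φ Ψ : LMap α β} (hΦ : IsChannel Φ) (hΨ : IsChannel Ψ) [Nonempty α]
    {ρ : Op (β × α)} (hρ : ρ.PosSemidef) {σ : Op α} (hσ : IsState σ)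
    (h : ((1 : Op β) ⊗ₖ σ - ρ).PosSemidef) :
    dotRe ρ (choi Φ - choi Ψ) ≤ diamondNorm (Ψ - Φ) / 2 := by
  have h1 : ∀ η : ℝ, 0 < η → dotRe ρ (choi Φ - choi Ψ)
      ≤ diamondNorm (Ψ - Φ) / 2 * (1 + η * Fintype.card α) := fun η hη => by
    have hpd : (σ + η • (1 : Op α)).PosDef := Matrix.PosDef.posSemidef_add hσ.1
      (Matrix.PosDef.one.smul hη)
    refine (dotRe_choi_sub_le_of_posDef hΦ hΨ hρ hpd ?_).trans_eq ?_
    · rw [Matrix.kronecker_add, add_sub_right_comm]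
      exact h.add (Matrix.PosSemidef.one.kronecker
        (posSemidef_real_smul Matrix.PosSemidef.one hη.le))
    · simp [hσ.2]
  have h2 : Filter.Tendsto (fun η : ℝ => diamondNorm (Ψ - Φ) / 2 * (1 + η * Fintype.card α))
      (nhdsWithin 0 (Set.Ioi 0))
      (nhds (diamondNorm (Ψ - Φ) / 2 * (1 + 0 * Fintype.card α))) := by
    refine Filter.Tendsto.mono_left ?_ nhdsWithin_le_nhds
    exact Continuous.tendsto (by fun_prop) 0
  have := ge_of_tendsto h2 (eventually_nhdsWithin_of_forall h1)
  linarith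

end Duality

/-! ### Domination, the conversion distance and the state criterion -/

variable {F : ConvexSubcategory.{u}} {A A' : IOSpace.{u}} {Φ₁ : A.Map} {Φ₂ : A'.Map}

/-- Some morphism in `F` transforms `Φ₁` to a map that dominates `Φ₂` up to `t` times a channel. -/
def ConvexSubcategory.Dominates (F : ConvexSubcategory.{u}) {A A' : IOSpace.{u}} (Φ₁ : A.Map)
    (Φ₂ : A'.Map) (t : ℝ) : Prop :=
  ∃ Θ ∈ F.hom A A', ∃ χ : A'.Map, IsChannel χ ∧
    (t • choi χ - (choi Φ₂ - choi (SuperMap.act Θ Φ₁))).PosSemidef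

theorem isHermitian_choi_sub_act (hA : A ∈ F.adm) (hA' : A' ∈ F.adm) (hΦ₁ : IsChannel Φ₁)
    (hΦ₂ : IsChannel Φ₂) {Θ : SuperMap A A'} (hΘ : Θ ∈ F.hom A A') :
    (choi Φ₂ - choi (SuperMap.act Θ Φ₁)).IsHermitian :=
  (isChannel_iff.1 hΦ₂).1.isHermitian.sub (isChannel_iff.1
    ((F.isSuperchannel A hA A' hA' Θ hΘ).isChannel_act hΦ₁)).1.isHermitian

/-- Choose Θ with diamond norm below 2t and apply the alternative to a single difference; a witness
would have value at least t yet at most half that norm. -/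
theorem dominates_of_delta_le (hA : A ∈ F.adm) (hA' : A' ∈ F.adm) (hΦ₁ : IsChannel Φ₁)
    (hΦ₂ : IsChannel Φ₂) {ε t : ℝ} (hε : 0 ≤ ε) (h : F.delta Φ₁ Φ₂ ≤ (ε : EReal))
    (ht : ε / 2 < t) : F.Dominates Φ₁ Φ₂ t := by
  have h1 : F.delta Φ₁ Φ₂ < ((2 * t : ℝ) : EReal) :=
    h.trans_lt (EReal.coe_lt_coe_iff.2 (by linarith))
  rw [ConvexSubcategory.delta] at h1
  simp only [iInf_lt_iff] at h1
  obtain ⟨Θ, hΘ, h2⟩ := h1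
  rw [EReal.coe_lt_coe_iff] at h2
  rcases exists_dominated_or_exists_witness (K := {choi Φ₂ - choi (SuperMap.act Θ Φ₁)})
    (convex_singleton _) (Set.singleton_nonempty _)
    (by rintro k rfl; exact isHermitian_choi_sub_act hA hA' hΦ₁ hΦ₂ hΘ)
    (t := t) (by linarith) with ⟨k, rfl, χ, hχ, h3⟩ | ⟨ρ, hρ, σ, hσ, h3, h4⟩
  · exact ⟨Θ, hΘ, χ, hχ, h3⟩
  · have h5 := dotRe_choi_sub_le hΦ₂ ((F.isSuperchannel A hA A' hA' Θ hΘ).isChannel_act hΦ₁)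
      hρ hσ h3
    have := h4 _ rfl
    linarith

theorem delta_le_of_forall_dominates (hA : A ∈ F.adm) (hA' : A' ∈ F.adm) (hΦ₁ : IsChannel Φ₁)
    (hΦ₂ : IsChannel Φ₂) {ε : ℝ} (hε : 0 ≤ ε) (h : ∀ t, ε / 2 < t → F.Dominates Φ₁ Φ₂ t) :
    F.delta Φ₁ Φ₂ ≤ (ε : EReal) := by
  refine EReal.le_of_forall_lt_iff_le.1 fun z hz => ?_
  rw [EReal.coe_lt_coe_iff] at hz
  obtain ⟨Θ, hΘ, χ, hχ, h1⟩ := h (z / 2) (by linarith)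
  refine (iInf₂_le Θ hΘ).trans (EReal.coe_le_coe_iff.2 ?_)
  have := hΦ₂.diamondNorm_sub_le ((F.isSuperchannel A hA A' hA' Θ hΘ).isChannel_act hΦ₁) hχ
    (by linarith) h1
  linarith

theorem pairing_sub_pairing {α β : Type*} [Fintype α] [DecidableEq α] [Fintype β] [DecidableEq β]
    (ρ : Op (β × α)) (c : ℝ) (φ ψ : LMap α β) :
    pairing (c • ρ.submatrix Prod.swap Prod.swap) φ
      - pairing (c • ρ.submatrix Prod.swap Prod.swap) ψ
      = c * dotRe ρ (choi φ - choi ψ) := by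
  have : (c • ρ.submatrix Prod.swap Prod.swap).submatrix Prod.swap Prod.swap = c • ρ := by
    ext p q; simp
  rw [pairing_eq_dotRe, pairing_eq_dotRe, ← dotRe_sub, this, smul_dotRe]

theorem exists_isState (α : Type*) [Fintype α] [DecidableEq α] [Nonempty α] :
    ∃ ρ : Op α, IsState ρ :=
  ⟨_, PosSemidef.isState_smul .one one_ne_zero⟩

/-- The minimax step: the action is linear in Θ, so convexity of F(A, A') lets one witness serve
against all Θ. The slack η avoids any closedness of F(A, A'). -/
theorem dominates_of_forall_state (hA : A ∈ F.adm) (hA' : A' ∈ F.adm) (hΦ₁ : IsChannel Φ₁)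
    (hΦ₂ : IsChannel Φ₂) {ε t : ℝ} (hε : 0 ≤ ε)
    (h : ∀ ρ : Op (A'.inp.idx × A'.out.idx), IsState ρ → ∀ η : ℝ, 0 < η → ∃ Θ ∈ F.hom A A',
      pairing ρ Φ₂ ≤ pairing ρ (SuperMap.act Θ Φ₁) + ε / 2 * dualDiamondNorm ρ + η)
    (ht : ε / 2 < t) : F.Dominates Φ₁ Φ₂ t := by
  let K : Set (Op (A'.out.idx × A'.inp.idx)) :=
    (fun Θ => choi Φ₂ - choi (SuperMap.act Θ Φ₁)) '' F.hom A A'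
  have hK : Convex ℝ K := by
    rintro _ ⟨Θ, hΘ, rfl⟩ _ ⟨Λ, hΛ, rfl⟩ a b ha hb hab
    refine ⟨a • Θ + b • Λ, F.convex A hA A' hA' hΘ hΛ ha hb hab, ?_⟩
    simp only [SuperMap.add_act, SuperMap.smul_act, choi_add, choi_smul, smul_sub]
    obtain rfl : a = 1 - b := by linarith
    module
  have hne : K.Nonempty := by
    obtain ⟨ρ, hρ⟩ := exists_isState (A'.inp.idx × A'.out.idx)
    obtain ⟨Θ, hΘ, -⟩ := h ρ hρ 1 one_pos
    exact ⟨_, Θ, hΘ, rfl⟩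
  have ht0 : 0 < t := by linarith
  rcases exists_dominated_or_exists_witness hK hne
    (by rintro _ ⟨Θ, hΘ, rfl⟩; exact isHermitian_choi_sub_act hA hA' hΦ₁ hΦ₂ hΘ)
    ht0 with ⟨_, ⟨Θ, hΘ, rfl⟩, χ, hχ, h3⟩ | ⟨ρ, hρ, σ, hσ, h3, h4⟩
  · exact ⟨Θ, hΘ, χ, hχ, h3⟩
  exfalso
  set ρ' : Op (A'.inp.idx × A'.out.idx) := ρ.submatrix Prod.swap Prod.swap with hρ'
  have hρ'p : ρ'.PosSemidef := hρ.submatrix _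
  have hback : ρ'.submatrix Prod.swap Prod.swap = ρ := by ext p q; simp [hρ']
  have hρ0 : ρ' ≠ 0 := by
    intro h0
    obtain ⟨k, hk⟩ := hne
    have := h4 k hk
    rw [← hback, h0] at this
    simp [dotRe] at this
    linarith
  have hc := PosSemidef.trace_re_pos hρ'p hρ0
  set c := (ρ'.trace.re)⁻¹ with hcdef
  have hc0 : 0 < c := by positivity
  have hst : IsState (c • ρ') := PosSemidef.isState_smul hρ'p hρ0
  -- Normalising ρ by c scales the bound 1 ⊗ σ as well, and σ has trace one.
  have hdual : dualDiamondNorm (c • ρ') ≤ c := by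
    refine (dualDiamondNorm_le hst.1 (posSemidef_real_smul hσ.1 hc0.le) ?_).trans_eq ?_
    · have : (c • ρ').submatrix Prod.swap Prod.swap = c • ρ := by
        rw [← hback]; rfl
      rw [this, Matrix.kronecker_smul, ← smul_sub]
      exact posSemidef_real_smul h3 hc0.le
    · simp [hσ.2]
  -- The witness forces a gap of at least tc, while the hypothesis allows εc/2 plus the slack; half
  -- of the difference is small enough.
  obtain ⟨Θ, hΘ, h5⟩ := h _ hst ((t - ε / 2) * c / 2)
    (by have := mul_pos (sub_pos.2 ht) hc0; linarith)
  have h6 := pairing_sub_pairing ρ c Φ₂ (SuperMap.act Θ Φ₁)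
  rw [← hρ'] at h6
  have h7 := mul_le_mul_of_nonneg_left (h4 _ ⟨Θ, hΘ, rfl⟩) hc0.le
  have h8 := mul_le_mul_of_nonneg_left hdual (by positivity : 0 ≤ ε / 2)
  have h9 := mul_pos (sub_pos.2 ht) hc0
  nlinarith

/-! ### Approximation and compactness for the closure of F(A, A') -/

theorem pairing_act_eq_dotRe (ρ : Op (A'.inp.idx × A'.out.idx)) (Θ : SuperMap A A') (Φ : A.Map) :
    pairing ρ (SuperMap.act Θ Φ)
      = dotRe ((linkChoi ρ Φ).submatrix Prod.swap Prod.swap) (choi Θ) := by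
  rw [pairing_act, pairing_eq_dotRe]

theorem exists_mem_hom_of_mem_closedHom (ρ : Op (A'.inp.idx × A'.out.idx)) {Θ : SuperMap A A'}
    (hΘ : Θ ∈ F.closedHom A A') (Φ : A.Map) {η : ℝ} (hη : 0 < η) :
    ∃ Λ ∈ F.hom A A', pairing ρ (SuperMap.act Θ Φ) - η < pairing ρ (SuperMap.act Λ Φ) := by
  have ho : IsOpen {C | pairing ρ (SuperMap.act Θ Φ) - η
      < dotRe ((linkChoi ρ Φ).submatrix Prod.swap Prod.swap) C} :=
    isOpen_lt continuous_const (continuous_dotRe _)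
  obtain ⟨_, hC, ⟨Λ, hΛ, rfl⟩⟩ := mem_closure_iff.1 hΘ _ ho (by
    rw [Set.mem_ofPred_eq, ← pairing_act_eq_dotRe]; linarith)
  refine ⟨Λ, hΛ, ?_⟩
  rwa [Set.mem_ofPred_eq, ← pairing_act_eq_dotRe] at hC

theorem isCompact_closure_choi_hom (hA : A ∈ F.adm) (hA' : A' ∈ F.adm) :
    IsCompact (closure (choi '' F.hom A A')) := by
  set c : ℝ := Fintype.card A'.inp.idx * Fintype.card A.out.idx with hc
  have hB : IsCompact {C : Op ((A'.out.idx × A.inp.idx) × (A'.inp.idx × A.out.idx)) |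
      ∀ i, (C i) ∈ {v : (A'.out.idx × A.inp.idx) × (A'.inp.idx × A.out.idx) → ℂ |
        ∀ j, v j ∈ Metric.closedBall (0 : ℂ) c}} :=
    isCompact_pi_infinite fun _ => isCompact_pi_infinite fun _ => isCompact_closedBall _ _
  refine hB.closure_of_subset ?_
  rintro _ ⟨Θ, hΘ, rfl⟩ i j
  have hs := F.isSuperchannel A hA A' hA' Θ hΘ
  rw [mem_closedBall_zero_iff]
  refine (PosSemidef.norm_apply_le hs.posSemidef_choi i j).trans_eq ?_
  rw [hs.trace_choi]
  simp [hc]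

theorem exists_isMax_closedHom (hA : A ∈ F.adm) (hA' : A' ∈ F.adm) (hne : (F.hom A A').Nonempty)
    (ρ : Op (A'.inp.idx × A'.out.idx)) (Φ : A.Map) :
    ∃ Θ ∈ F.closedHom A A', ∀ Λ ∈ F.hom A A',
      pairing ρ (SuperMap.act Λ Φ) ≤ pairing ρ (SuperMap.act Θ Φ) := by
  obtain ⟨C, hC, hmax⟩ := (isCompact_closure_choi_hom hA hA').exists_isMaxOn
    (hne.image choi).closure
    (continuous_dotRe ((linkChoi ρ Φ).submatrix Prod.swap Prod.swap)).continuousOn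
  refine ⟨ofChoi C, ?_, fun Λ hΛ => ?_⟩
  · rwa [ConvexSubcategory.closedHom, Set.mem_ofPred_eq, choi_ofChoi]
  · rw [pairing_act_eq_dotRe, pairing_act_eq_dotRe, choi_ofChoi]
    exact hmax (subset_closure ⟨Λ, hΛ, rfl⟩)

/-! ### Transport of domination along morphisms and the norm inequalities -/

/-- A superchannel Λ preserves the order: Λ(Φ₂) ≤ Λ(Θ(Φ₁)) + tΛ(χ). The composite lies in F, and
Λ(χ) is a channel, so its pairing with ρ is at most the dual norm. -/
theorem pairing_act_le_of_dominates {R : IOSpace.{u}} (hA : A ∈ F.adm) (hA' : A' ∈ F.adm)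
    (hR : R ∈ F.adm) {t : ℝ} (ht : 0 ≤ t) (h : F.Dominates Φ₁ Φ₂ t)
    {ρ : Op (R.inp.idx × R.out.idx)} (hρ : ρ.PosSemidef) {Λ : SuperMap A' R}
    (hΛ : Λ ∈ F.hom A' R) :
    ∃ Ω ∈ F.hom A R, pairing ρ (SuperMap.act Λ Φ₂)
      ≤ pairing ρ (SuperMap.act Ω Φ₁) + t * dualDiamondNorm ρ := by
  obtain ⟨Θ, hΘ, χ, hχ, h1⟩ := h
  obtain ⟨Ω, hΩ, h2⟩ := F.comp_mem A hA A' hA' R hR Θ hΘ Λ hΛ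
  refine ⟨Ω, hΩ, ?_⟩
  have hs := F.isSuperchannel A' hA' R hR Λ hΛ
  have h3 : (choi (t • χ - (Φ₂ - SuperMap.act Θ Φ₁))).PosSemidef := by
    rwa [choi_sub, choi_sub, choi_smul]
  have h4 := SuperMap.posSemidef_choi_act hs.posSemidef_choi h3
  have h5 : SuperMap.act Λ Φ₂ + SuperMap.act Λ (t • χ - (Φ₂ - SuperMap.act Θ Φ₁))
      = SuperMap.act Ω Φ₁ + t • SuperMap.act Λ χ := by
    rw [h2, ← SuperMap.act_smul, ← SuperMap.act_add, ← SuperMap.act_add]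
    congr 1
    abel
  have h6 := pairing_le_pairing (φ := SuperMap.act Λ Φ₂)
    (χ := SuperMap.act Ω Φ₁ + t • SuperMap.act Λ χ) hρ (by
      rw [← h5, choi_add, add_sub_cancel_left]; exact h4)
  refine h6.trans ?_
  rw [pairing_add]
  have h7 : pairing ρ (t • SuperMap.act Λ χ) = t * pairing ρ (SuperMap.act Λ χ) := by
    rw [pairing_eq_dotRe, choi_smul, dotRe_smul, pairing_eq_dotRe]
  rw [h7]
  have := mul_le_mul_of_nonneg_left (pairing_le_dualDiamondNorm hρ (hs.isChannel_act hχ)) ht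
  linarith

theorem EReal.coe_le_add_coe_of_forall_lt {x d s : ℝ} {m : EReal}
    (h : ∀ t, s < t → (x : EReal) ≤ m + ((t * d : ℝ) : EReal)) :
    (x : EReal) ≤ m + ((s * d : ℝ) : EReal) := by
  induction m with
  -- With no morphism the supremum is −∞ and stays so after adding a real, so a single t already
  -- decides.
  | bot => simpa using h (s + 1) (by linarith)
  | top => rw [EReal.top_add_coe]; exact le_top
  | coe r =>
    simp only [← EReal.coe_add, EReal.coe_le_coe_iff] at h ⊢
    by_contra! hlt
    have h1 := h (s + (x - (r + s * d)) / (2 * (|d| + 1)))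
      (by have : 0 < (x - (r + s * d)) / (2 * (|d| + 1)) := div_pos (by linarith) (by positivity)
          linarith)
    have h2 : (x - (r + s * d)) / (2 * (|d| + 1)) * d ≤ (x - (r + s * d)) / 2 := by
      rw [div_mul_eq_mul_div, div_le_div_iff₀ (by positivity) two_pos]
      nlinarith [le_abs_self d]
    linarith

theorem modNorm_le_of_forall_dominates {R : IOSpace.{u}} (hA : A ∈ F.adm) (hA' : A' ∈ F.adm)
    (hR : R ∈ F.adm) {ε : ℝ} (hε : 0 ≤ ε) (h : ∀ t, ε / 2 < t → F.Dominates Φ₁ Φ₂ t)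
    {ρ : Op (R.inp.idx × R.out.idx)} (hρ : IsState ρ) :
    F.modNorm A' R (linkChoi ρ Φ₂) ≤
      F.modNorm A R (linkChoi ρ Φ₁) + ((ε / 2 * dualDiamondNorm ρ : ℝ) : EReal) := by
  refine iSup₂_le fun Λ hΛ => EReal.coe_le_add_coe_of_forall_lt fun t ht => ?_
  obtain ⟨Ω, hΩ, h1⟩ := pairing_act_le_of_dominates hA hA' hR (by linarith) (h t ht) hρ.1 hΛ
  rw [← pairing_act]
  refine (EReal.coe_le_coe_iff.2 h1).trans ?_
  rw [EReal.coe_add, pairing_act]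
  gcongr
  exact le_iSup₂ (f := fun (Θ : SuperMap A R) (_ : Θ ∈ F.hom A R) =>
    ((pairing (linkChoi ρ Φ₁) Θ : ℝ) : EReal)) Ω hΩ

/-- The identity morphism makes ⟨ρ, Φ₂⟩ a lower bound for the left side, and the supremum on the
right is approached within η. -/
theorem exists_pairing_le_of_modNorm_le (hA' : A' ∈ F.adm) {c : ℝ}
    {ρ : Op (A'.inp.idx × A'.out.idx)}
    (h : F.modNorm A' A' (linkChoi ρ Φ₂) ≤ F.modNorm A A' (linkChoi ρ Φ₁) + (c : EReal))
    {η : ℝ} (hη : 0 < η) :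
    ∃ Θ ∈ F.hom A A', pairing ρ Φ₂ ≤ pairing ρ (SuperMap.act Θ Φ₁) + c + η := by
  obtain ⟨I, hI, hid⟩ := F.id_mem A' hA'
  have h1 : ((pairing ρ Φ₂ : ℝ) : EReal) ≤ F.modNorm A' A' (linkChoi ρ Φ₂) := by
    rw [← hid Φ₂, pairing_act, hid Φ₂]
    exact le_iSup₂ (f := fun (Θ : SuperMap A' A') (_ : Θ ∈ F.hom A' A') =>
      ((pairing (linkChoi ρ Φ₂) Θ : ℝ) : EReal)) I hI
  by_contra! hlt
  have h2 : F.modNorm A A' (linkChoi ρ Φ₁) ≤ ((pairing ρ Φ₂ - c - η : ℝ) : EReal) := by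
    refine iSup₂_le fun Θ hΘ => EReal.coe_le_coe_iff.2 ?_
    have := hlt Θ hΘ
    rw [pairing_act] at this
    linarith
  have h3 := (h1.trans h).trans (add_le_add_left h2 (c : EReal))
  rw [← EReal.coe_add, EReal.coe_le_coe_iff] at h3
  linarith

end ChannelComparison

theorem theorem3 (F : ConvexSubcategory.{u}) (A A' : IOSpace.{u})
    (hA : A ∈ F.adm) (hA' : A' ∈ F.adm)
    (Φ₁ : A.Map) (Φ₂ : A'.Map) (hΦ₁ : IsChannel Φ₁) (hΦ₂ : IsChannel Φ₂)
    (ε : ℝ) (hε : 0 ≤ ε) :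
    List.TFAE
      [ F.delta Φ₁ Φ₂ ≤ (ε : EReal),
        ∀ ρ : Op (A'.inp.idx × A'.out.idx), IsState ρ →
          ∃ Θ ∈ F.closedHom A A',
            pairing ρ Φ₂ ≤ pairing ρ (SuperMap.act Θ Φ₁) + ε / 2 * dualDiamondNorm ρ,
        ∀ R ∈ F.adm, ∀ ρ : Op (R.inp.idx × R.out.idx), IsState ρ →
          F.modNorm A' R (linkChoi ρ Φ₂) ≤
            F.modNorm A R (linkChoi ρ Φ₁) + ((ε / 2 * dualDiamondNorm ρ : ℝ) : EReal),
        ∀ R ∈ F.adm, Nonempty (R.inp.idx ≃ A'.inp.idx) → Nonempty (R.out.idx ≃ A'.out.idx) →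
          ∀ ρ : Op (R.inp.idx × R.out.idx), IsState ρ →
            F.modNorm A' R (linkChoi ρ Φ₂) ≤
              F.modNorm A R (linkChoi ρ Φ₁) + ((ε / 2 * dualDiamondNorm ρ : ℝ) : EReal),
        ∀ ρ : Op (A'.inp.idx × A'.out.idx), IsState ρ →
          F.modNorm A' A' (linkChoi ρ Φ₂) ≤
            F.modNorm A A' (linkChoi ρ Φ₁) + ((ε / 2 * dualDiamondNorm ρ : ℝ) : EReal) ] := by
  tfae_have 1 → 3 := fun h R hR ρ hρ => modNorm_le_of_forall_dominates hA hA' hR hε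
    (fun t ht => dominates_of_delta_le hA hA' hΦ₁ hΦ₂ hε h ht) hρ
  tfae_have 3 → 4 := fun h R hR _ _ => h R hR
  tfae_have 4 → 5 := fun h => h A' hA' ⟨Equiv.refl _⟩ ⟨Equiv.refl _⟩
  tfae_have 5 → 2 := fun h ρ hρ => by
    have h1 := fun (η : ℝ) (hη : 0 < η) => exists_pairing_le_of_modNorm_le hA' (h ρ hρ) hη
    -- Any positive slack shows that F(A, A') is nonempty, which the maximum over the closure
    -- requires.
    obtain ⟨Λ, hΛ, -⟩ := h1 1 one_pos
    obtain ⟨Θ, hΘ, hmax⟩ := exists_isMax_closedHom hA hA' ⟨Λ, hΛ⟩ ρ Φ₁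
    refine ⟨Θ, hΘ, le_of_forall_pos_le_add fun η hη => ?_⟩
    obtain ⟨Ω, hΩ, h2⟩ := h1 η hη
    linarith [hmax Ω hΩ]
  tfae_have 2 → 1 := fun h => by
    refine delta_le_of_forall_dominates hA hA' hΦ₁ hΦ₂ hε fun t ht =>
      dominates_of_forall_state hA hA' hΦ₁ hΦ₂ hε (fun ρ hρ η hη => ?_) ht
    obtain ⟨Θ, hΘ, h1⟩ := h ρ hρ
    obtain ⟨Λ, hΛ, h2⟩ := exists_mem_hom_of_mem_closedHom ρ hΘ Φ₁ hη
    exact ⟨Λ, hΛ, by linarith⟩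
  tfae_finish
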